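/- Write $\Delta_j u=\mathcal F^{-1}(\varphi(2^{-j}|\xi|)\hat u)$ and $\Delta_k^h u=\mathcal F^{-1}(\varphi(2^{-k}|\xi_1|)\hat u)$ for $j,k\in\mathbb Z$ and a tempered distribution $u$ on $\mathbb R^2$, where $\varphi$ is a fixed smooth function supported in $[\frac34,\frac83]$ with $\sum_{j\in\mathbb Z}\varphi(2^{-j}\tau)=1$ for all $\tau>0$. For $s_1,s_2\in\mathbb R$ set $$\|u\|_{\mathcal B^{s_1,s_2}}=\sum_{j,k\in\mathbb Z}2^{js_1}2^{ks_2}\|\Delta_j\Delta_k^h u\|_{L^2(\mathbb R^2)}\in[0,\infty].$$ **Proposition.** There is a constant $C$, depending only on $\varphi$, such that the following holds. Let $T>0$, and let $Y$ be a sufficiently smooth solution on $[0,T]\times\mathbb R^2$ of $$Y_{tt}-\Delta Y_t-\partial_1^2Y=f,\qquad Y|_{t=0}=Y_0,\quad Y_t|_{t=0}=Y_1,$$ with values in $\mathbb R^2$ (or $\mathbb C^2$); it suffices that $Y(t)$ and $f(t)$ are tempered distributions for each $t\in[0,T]$, that $Y$ is differentiable in time (tested against each Schwartz function) with $Y_t\in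 C^1([0,T];L^2(\mathbb R^2))$, and that the equation holds in the sense of tempered distributions for every $t\in[0,T]$. Then $$\|\nabla Y_t\|_{L^1_T(L^\infty)}\le C\,\|Y_t\|_{L^1_T(\mathcal B^{3/2,1/2})}$$ and $$\|Y_t\|_{L^1_T(\mathcal B^{3/2,1/2})}\le C\Big(\|Y_1\|_{\mathcal B^{-1/2,1/2}}+\|\partial_1Y_0\|_{\mathcal B^{-1/2,1/2}}+\|\Delta Y_0\|_{\mathcal B^{-1/2,1/2}}+\|f\|_{L^1_T(\mathcal B^{0,0})}\Big),$$ where $\|u\|_{L^1_T(X)}=\int_0^T\|u(t)\|_X\,dt$ and both sides may be infinite. -/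

import Mathlib

open MeasureTheory Set
open scoped ENNReal NNReal SchwartzMap FourierTransform LineDeriv Laplacian ContDiff

noncomputable section

/-- The plane `ℝ²`. -/
abbrev Plane : Type := EuclideanSpace ℝ (Fin 2)

/-- The values of the unknown `Y = (Y¹, Y²)`. -/
abbrev Val : Type := EuclideanSpace ℂ (Fin 2)

/-- `L²(ℝ²)` with values in `Val`. -/
abbrev PlaneL2 : Type := Lp Val 2 (volume : Measure Plane)

/-- The tempered distribution given by an `L²` function. -/
abbrev PlaneL2.toDist (u : PlaneL2) : 𝓢'(Plane, Val) := Lp.toTemperedDistribution u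

/-- The unit vectors of `ℝ²`; `unitVec 0` is the `x₁` (horizontal) direction and `unitVec 1`
the `x₂` (vertical) direction. -/
def unitVec (i : Fin 2) : Plane := EuclideanSpace.single i 1

/-- A Littlewood-Paley profile: a smooth function `φ` supported in `[3/4, 8/3]` whose dyadic
dilates sum to `1` on `(0, ∞)`. -/
structure IsDyadicProfile (φ : ℝ → ℝ) : Prop where
  smooth : ContDiff ℝ ∞ φ
  support_subset : Function.support φ ⊆ Icc (3 / 4) (8 / 3)
  hasSum_one : ∀ τ : ℝ, 0 < τ → HasSum (fun j : ℤ ↦ φ ((2 : ℝ) ^ (-j) * τ)) 1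

/-- The symbol `φ(2^{-j}|ξ|)` of `Δ_j`, as a function of the variable `η = ξ / (2π)` of
Mathlib's Fourier transform `∫ e^{-2πi x·η} u(x) dx`. -/
def isoSymbol (φ : ℝ → ℝ) (j : ℤ) (η : Plane) : ℂ :=
  (φ ((2 : ℝ) ^ (-j) * (2 * Real.pi * ‖η‖)) : ℂ)

/-- The symbol `φ(2^{-k}|ξ₁|)` of `Δ_k^h`, with `ξ = 2πη`. -/
def horSymbol (φ : ℝ → ℝ) (k : ℤ) (η : Plane) : ℂ :=
  (φ ((2 : ℝ) ^ (-k) * (2 * Real.pi * |η 0|)) : ℂ)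

lemma IsDyadicProfile.radial_hasTemperateGrowth {φ : ℝ → ℝ} (hφ : IsDyadicProfile φ)
    {H : Type*} [NormedAddCommGroup H] [InnerProductSpace ℝ H] [FiniteDimensional ℝ H]
    {c : ℝ} (hc : 0 < c) :
    Function.HasTemperateGrowth (fun η : H ↦ (φ (c * ‖η‖) : ℂ)) := by
  have hzero : ∀ τ : ℝ, τ ∉ Icc (3 / 4 : ℝ) (8 / 3) → φ τ = 0 := fun τ hτ ↦ by
    by_contra h
    exact hτ (hφ.support_subset h)
  refine HasCompactSupport.hasTemperateGrowth ?_ ?_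
  · refine HasCompactSupport.intro (isCompact_closedBall (0 : H) (8 / 3 / c)) fun η hη ↦ ?_
    have h1 : 8 / 3 / c < ‖η‖ := by simpa using hη
    have h2 : 8 / 3 < c * ‖η‖ := by
      rw [div_lt_iff₀ hc] at h1
      linarith
    rw [hzero _ fun h ↦ absurd h.2 (not_le.2 h2)]
    simp
  · rw [contDiff_iff_contDiffAt]
    intro η
    by_cases hη : η = 0
    · subst hη
      have hev : ∀ᶠ x : H in nhds 0, c * ‖x‖ < 3 / 4 := by
        have hcont : Continuous fun x : H ↦ c * ‖x‖ := by fun_prop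
        exact hcont.continuousAt.eventually_lt continuousAt_const (by norm_num)
      refine (contDiffAt_const (c := (0 : ℂ))).congr_of_eventuallyEq ?_
      filter_upwards [hev] with x hx
      rw [hzero _ fun h ↦ absurd h.1 (not_le.2 hx)]
      simp
    · have h1 : ContDiffAt ℝ ∞ (fun x : H ↦ c * ‖x‖) η :=
        contDiffAt_const.mul (contDiffAt_norm ℝ hη)
      have h2 : ContDiffAt ℝ ∞ (fun x : H ↦ φ (c * ‖x‖)) η :=
        (hφ.smooth.contDiffAt).comp η h1
      exact Complex.ofRealCLM.contDiff.contDiffAt.comp η h2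

/-- The symbols have temperate growth, so that the multipliers below are the genuine ones. -/
lemma IsDyadicProfile.isoSymbol_hasTemperateGrowth {φ : ℝ → ℝ} (hφ : IsDyadicProfile φ)
    (j : ℤ) : (isoSymbol φ j).HasTemperateGrowth := by
  have h := hφ.radial_hasTemperateGrowth (H := Plane)
    (c := (2 : ℝ) ^ (-j) * (2 * Real.pi)) (by positivity)
  have e : isoSymbol φ j = fun η : Plane ↦ (φ ((2 : ℝ) ^ (-j) * (2 * Real.pi) * ‖η‖) : ℂ) := by
    funext η
    simp only [isoSymbol, mul_assoc]
  rw [e]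
  exact h

lemma IsDyadicProfile.horSymbol_hasTemperateGrowth {φ : ℝ → ℝ} (hφ : IsDyadicProfile φ)
    (k : ℤ) : (horSymbol φ k).HasTemperateGrowth := by
  have h := hφ.radial_hasTemperateGrowth (H := ℝ)
    (c := (2 : ℝ) ^ (-k) * (2 * Real.pi)) (by positivity)
  have h' := h.comp
    (EuclideanSpace.proj (0 : Fin 2) : Plane →L[ℝ] ℝ).hasTemperateGrowth
  have e : horSymbol φ k =
      (fun η : ℝ ↦ (φ ((2 : ℝ) ^ (-k) * (2 * Real.pi) * ‖η‖) : ℂ)) ∘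
        (EuclideanSpace.proj (0 : Fin 2) : Plane →L[ℝ] ℝ) := by
    funext η
    simp only [horSymbol, mul_assoc, Function.comp, Real.norm_eq_abs]
    rfl
  rw [e]
  exact h'

/-- The isotropic dyadic block `Δ_j u = 𝓕⁻¹(φ(2^{-j}|ξ|) û)`. -/
def isoBlock (φ : ℝ → ℝ) (j : ℤ) (u : 𝓢'(Plane, Val)) : 𝓢'(Plane, Val) :=
  TemperedDistribution.fourierMultiplierCLM Val (isoSymbol φ j) u

/-- The horizontal dyadic block `Δ_k^h u = 𝓕⁻¹(φ(2^{-k}|ξ₁|) û)`. -/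
def horBlock (φ : ℝ → ℝ) (k : ℤ) (u : 𝓢'(Plane, Val)) : 𝓢'(Plane, Val) :=
  TemperedDistribution.fourierMultiplierCLM Val (horSymbol φ k) u

/-- The `L^p(ℝ²)` norm of a tempered distribution: the norm of the `L^p` function which
represents it, and `∞` if there is none. -/
def distLpNorm (p : ℝ≥0∞) [Fact (1 ≤ p)] (u : 𝓢'(Plane, Val)) : ℝ≥0∞ :=
  ⨅ (g : Lp Val p (volume : Measure Plane)) (_ : (g : 𝓢'(Plane, Val)) = u), ‖g‖ₑ

/-- The anisotropic Besov norm
`‖u‖_{𝓑^{s₁,s₂}} = ∑_{j,k ∈ ℤ} 2^{j s₁} 2^{k s₂} ‖Δ_j Δ_k^h u‖_{L²}`. -/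
def anisoBesovNorm (φ : ℝ → ℝ) (s₁ s₂ : ℝ) (u : 𝓢'(Plane, Val)) : ℝ≥0∞ :=
  ∑' (j : ℤ) (k : ℤ), (2 : ℝ≥0∞) ^ ((j : ℝ) * s₁) * (2 : ℝ≥0∞) ^ ((k : ℝ) * s₂) *
    distLpNorm 2 (isoBlock φ j (horBlock φ k u))

/-- `‖∇u‖_{L^∞} = ‖∂₁u‖_{L^∞} + ‖∂₂u‖_{L^∞}`, with distributional derivatives. -/
def gradSupNorm (u : 𝓢'(Plane, Val)) : ℝ≥0∞ :=
  ∑ i : Fin 2, distLpNorm ∞ (∂_{unitVec i} u)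

/-- The norm of `L¹([0,T]; X)`, for the norm `N` of `X`. -/
def L1TNorm {X : Type*} (T : ℝ) (N : X → ℝ≥0∞) (u : ℝ → X) : ℝ≥0∞ :=
  ∫⁻ t in Icc 0 T, N (u t)

/-- `Y` is a solution on `[0,T]` of
`Y_tt - ΔY_t - ∂₁²Y = f`, `Y|_{t=0} = Y₀`, `Y_t|_{t=0} = Y₁`,
with `Yt` its time derivative, which is in `C¹([0,T]; L²)`. -/
structure IsSolution (T : ℝ) (f Y : ℝ → 𝓢'(Plane, Val)) (Yt : ℝ → PlaneL2)
    (Y₀ : 𝓢'(Plane, Val)) (Y₁ : PlaneL2) : Prop where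
  hasDeriv : ∀ t ∈ Icc 0 T, ∀ ψ : 𝓢(Plane, ℂ),
    HasDerivWithinAt (fun s ↦ Y s ψ) (PlaneL2.toDist (Yt t) ψ) (Icc 0 T) t
  contDiffOn : ContDiffOn ℝ 1 Yt (Icc 0 T)
  equation : ∀ t ∈ Icc 0 T,
    PlaneL2.toDist (derivWithin Yt (Icc 0 T) t) - Δ (PlaneL2.toDist (Yt t)) - ∂_{unitVec 0} (∂_{unitVec 0} (Y t)) = f t
  initial : Y 0 = Y₀
  initial_deriv : Yt 0 = Y₁

end

/-!
The equation is studied on the Fourier side, one anisotropic block `Δ_j Δ_k^h` at a time, with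
`ξ = 2πη` for the variable `η` of Mathlib's Fourier transform.

*A priori estimate.* On the block, `w = 𝓕(Δ_jΔ_k^h Y_t)`, `z = iξ₁ 𝓕(Δ_jΔ_k^h Y)` and
`x = -|ξ|² 𝓕(Δ_jΔ_k^h Y)` are curves in `L²` solving `w' = G - A w + Q z`, `z' = Q w`, `x' = -A w`
with `Q x = -A z`, where `A` and `Q` are multiplication by `|ξ|² ∼ 4^j` and `iξ₁`, `|ξ₁| ∼ 2^k`.
Working with `z` and `x` instead of `𝓕(Δ_jΔ_k^h Y)` makes division by a symbol unnecessary.  The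
energy `E = ‖w‖² + ‖z‖² + ½‖x‖² - ⟪w, x⟫` satisfies
`E' = -⟪A w, w⟫ - ⟪A z, z⟫ + ⟪G, 2w - x⟫` and `‖2w - x‖ ≤ 2√E`.  If `4^j ≲ 2^k`, then `E` decays at
the parabolic rate `4^j`, which bounds `4^j ∫‖w‖`.  Otherwise its rate is only `4^{k-j}`, but this
bounds `∫‖Q z‖`, and `w` then solves a heat equation with an integrable source.  In both cases
`4^j ∫‖w‖` is controlled by the data of the block and `∫‖G‖`
(`integral_norm_le_of_damped_system`, `IsSolution.integral_norm_blockL2_le`).  Multiplying by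
`2^{-j/2} 2^{k/2}`, which is bounded because `|ξ₁| ≤ |ξ|`, and summing over the blocks gives the
estimate; when a block of the data is not in `L²`, the right-hand side is infinite.

*Gradient bound.* `‖∂ᵢu‖_{L^∞}` is at most `∫ |ξ| |û|`.  The blocks cover almost every frequency,
and by Cauchy-Schwarz on a region of area `≲ 2^{j+k}` a block contributes at most
`2^{3j/2} 2^{k/2} ‖Δ_jΔ_k^h u‖_{L²}` up to a constant (`lintegral_blockL2_le`).
-/

noncomputable section

/-! ### Energy estimates in a Hilbert space -/

/-- Integrated form of the differential inequality `(√E)' + ρ √E ≤ h`. -/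
theorem integral_sqrt_le_of_deriv_le {T ρ : ℝ} (hT : 0 ≤ T) (hρ : 0 ≤ ρ) {E E' h : ℝ → ℝ}
    (hE : ∀ t ∈ Icc 0 T, HasDerivWithinAt E (E' t) (Icc 0 T) t)
    (hE0 : ∀ t ∈ Icc 0 T, 0 ≤ E t) (hh : ContinuousOn h (Icc 0 T))
    (hh0 : ∀ t ∈ Icc 0 T, 0 ≤ h t)
    (hle : ∀ t ∈ Icc 0 T, E' t ≤ -(2 * ρ) * E t + 2 * h t * √(E t)) :
    ρ * ∫ t in (0 : ℝ)..T, √(E t) ≤ √(E 0) + ∫ t in (0 : ℝ)..T, h t := by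
  have hEc : ContinuousOn E (Icc 0 T) := fun t ht ↦ (hE t ht).continuousWithinAt
  have hsc : ContinuousOn (fun t ↦ √(E t)) (Icc 0 T) := hEc.sqrt
  have hsi : IntervalIntegrable (fun t ↦ √(E t)) volume 0 T :=
    (hsc.mono (by rw [uIcc_of_le hT])).intervalIntegrable
  have hhi : IntervalIntegrable h volume 0 T :=
    (hh.mono (by rw [uIcc_of_le hT])).intervalIntegrable
  -- `√E` need not be differentiable where `E` vanishes, so `√(E + ε²)` is used, with `ε → 0`.
  have key : ∀ ε : ℝ, 0 < ε →
      ρ * ∫ t in (0 : ℝ)..T, √(E t) ≤ √(E 0 + ε ^ 2) + (∫ t in (0 : ℝ)..T, h t) + ρ * ε * T := by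
    intro ε hε
    have hpos : ∀ t ∈ Icc 0 T, 0 < E t + ε ^ 2 := fun t ht ↦ by
      have := hE0 t ht
      positivity
    have h1 : √(E T + ε ^ 2) - √(E 0 + ε ^ 2) ≤
        ∫ t in (0 : ℝ)..T, (h t - ρ * √(E t) + ρ * ε) := by
      refine intervalIntegral.sub_le_integral_of_hasDeriv_right_of_le hT
        (g := fun t ↦ √(E t + ε ^ 2))
        (g' := fun t ↦ E' t / (2 * √(E t + ε ^ 2))) ?_ ?_ ?_ ?_
      · exact (hEc.add continuousOn_const).sqrt
      · intro t ht
        have ht' := Ioo_subset_Icc_self ht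
        have hd : HasDerivAt E (E' t) t := (hE t ht').hasDerivAt (Icc_mem_nhds ht.1 ht.2)
        exact ((hd.add_const _).sqrt (hpos t ht').ne').hasDerivWithinAt
      · refine ContinuousOn.integrableOn_Icc ?_
        exact (hh.sub (continuousOn_const.mul hsc)).add continuousOn_const
      · intro t ht
        have ht' := Ioo_subset_Icc_self ht
        set S := √(E t + ε ^ 2) with hS
        have hS0 : 0 < S := Real.sqrt_pos.2 (hpos t ht')
        have hSS : S ^ 2 = E t + ε ^ 2 := Real.sq_sqrt (hpos t ht').le
        have hs0 : 0 ≤ √(E t) := Real.sqrt_nonneg _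
        have hss : √(E t) ^ 2 = E t := Real.sq_sqrt (hE0 t ht')
        have hsS : √(E t) ≤ S := Real.sqrt_le_sqrt (by nlinarith)
        have hεS : ε ≤ S := by
          refine Real.le_sqrt_of_sq_le ?_
          have := hE0 t ht'
          linarith
        rw [div_le_iff₀ (by positivity)]
        have h2 := hle t ht'
        have h3 : h t * √(E t) ≤ h t * S := mul_le_mul_of_nonneg_left hsS (hh0 t ht')
        have h4 : (√(E t) - ε) * S ≤ E t := by
          have : E t = S ^ 2 - ε ^ 2 := by linarith
          nlinarith
        have h5 := mul_le_mul_of_nonneg_left h4 hρ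
        nlinarith
    have h2 : ∫ t in (0 : ℝ)..T, (h t - ρ * √(E t) + ρ * ε) =
        (∫ t in (0 : ℝ)..T, h t) - ρ * (∫ t in (0 : ℝ)..T, √(E t)) + ρ * ε * T := by
      rw [intervalIntegral.integral_add (hhi.sub (hsi.const_mul ρ)) (by simp),
        intervalIntegral.integral_sub hhi (hsi.const_mul ρ),
        intervalIntegral.integral_const_mul, intervalIntegral.integral_const]
      simp [mul_comm]
    have h3 : 0 ≤ √(E T + ε ^ 2) := Real.sqrt_nonneg _
    linarith
  have hlim : Filter.Tendsto
      (fun ε : ℝ ↦ √(E 0 + ε ^ 2) + (∫ t in (0 : ℝ)..T, h t) + ρ * ε * T)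
      (nhdsWithin 0 (Ioi 0)) (nhds (√(E 0) + ∫ t in (0 : ℝ)..T, h t)) := by
    have hc : Continuous
        (fun ε : ℝ ↦ √(E 0 + ε ^ 2) + (∫ t in (0 : ℝ)..T, h t) + ρ * ε * T) := by fun_prop
    have := hc.tendsto 0
    simp only [mul_zero, zero_mul, add_zero, ne_eq, OfNat.ofNat_ne_zero, not_false_eq_true,
      zero_pow] at this
    exact this.mono_left nhdsWithin_le_nhds
  refine ge_of_tendsto hlim ?_
  filter_upwards [self_mem_nhdsWithin] with ε hε using key ε hε

open scoped RealInnerProductSpace in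
/-- The decay estimate for the first-order system `w' = G - A w + Q z`, `z' = Q w`, `x' = -A w`
under the constraint `Q x = -A z`, where `A` is symmetric with spectrum in `[α, κ²α]` and `Q` is
skew-symmetric with `|Q|` in `[β, κβ]`.  The constant does not depend on `α`, `β`, `T`. -/
theorem integral_norm_le_of_damped_system {H : Type*} [NormedAddCommGroup H]
    [InnerProductSpace ℝ H] (A Q : H →L[ℝ] H)
    (hA : ∀ u v, ⟪A u, v⟫ = ⟪u, A v⟫) (hQ : ∀ u v, ⟪Q u, v⟫ = -⟪u, Q v⟫)
    {α β κ : ℝ} (hα : 0 < α) (hβ : 0 < β) (hκ : 0 ≤ κ)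
    (hA1 : ∀ u, α * ‖u‖ ^ 2 ≤ ⟪A u, u⟫) (hA2 : ∀ u, ‖A u‖ ≤ κ ^ 2 * α * ‖u‖)
    (hQ1 : ∀ u, β * ‖u‖ ≤ ‖Q u‖) (hQ2 : ∀ u, ‖Q u‖ ≤ κ * β * ‖u‖)
    {T : ℝ} (hT : 0 ≤ T) {w z x G : ℝ → H}
    (hw : ∀ t ∈ Icc 0 T, HasDerivWithinAt w (G t - A (w t) + Q (z t)) (Icc 0 T) t)
    (hz : ∀ t ∈ Icc 0 T, HasDerivWithinAt z (Q (w t)) (Icc 0 T) t)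
    (hx : ∀ t ∈ Icc 0 T, HasDerivWithinAt x (-A (w t)) (Icc 0 T) t)
    (hG : ContinuousOn G (Icc 0 T)) (hxz : ∀ t ∈ Icc 0 T, Q (x t) = -A (z t)) :
    α * ∫ t in (0 : ℝ)..T, ‖w t‖ ≤ (1 + 24 * (1 + κ ^ 2) * (1 + κ ^ 4)) *
      (‖w 0‖ + ‖z 0‖ + ‖x 0‖ + ∫ t in (0 : ℝ)..T, ‖G t‖) := by
  have hwc : ContinuousOn w (Icc 0 T) := fun t ht ↦ (hw t ht).continuousWithinAt
  have hzc : ContinuousOn z (Icc 0 T) := fun t ht ↦ (hz t ht).continuousWithinAt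
  have hxc : ContinuousOn x (Icc 0 T) := fun t ht ↦ (hx t ht).continuousWithinAt
  have hint : ∀ g : ℝ → ℝ, ContinuousOn g (Icc 0 T) → IntervalIntegrable g volume 0 T :=
    fun g hg ↦ (hg.mono (by rw [uIcc_of_le hT])).intervalIntegrable
  set E : ℝ → ℝ := fun t ↦ ‖w t‖ ^ 2 + ‖z t‖ ^ 2 + ‖x t‖ ^ 2 / 2 - ⟪w t, x t⟫ with hEdef
  set E' : ℝ → ℝ := fun t ↦ -⟪A (w t), w t⟫ - ⟪A (z t), z t⟫ + ⟪G t, (2 : ℝ) • w t - x t⟫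
    with hE'def
  have hE : ∀ t ∈ Icc 0 T, HasDerivWithinAt E (E' t) (Icc 0 T) t := by
    intro t ht
    have h := ((((hw t ht).norm_sq).add ((hz t ht).norm_sq)).add
      (((hx t ht).norm_sq).div_const 2)).sub ((hw t ht).inner ℝ (hx t ht))
    refine h.congr_deriv ?_
    -- The terms in `Q` cancel by skew-symmetry, except `-⟪Q z, x⟫`, which the constraint turns into
    -- damping of `z`.
    have e1 : ⟪Q (z t), x t⟫ = ⟪A (z t), z t⟫ := by
      rw [hQ, hxz t ht, inner_neg_right, neg_neg, hA]
    have e2 : ⟪w t, Q (z t)⟫ = -⟪z t, Q (w t)⟫ := by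
      rw [real_inner_comm, hQ]
    have e3 : ⟪w t, A (w t)⟫ = ⟪A (w t), w t⟫ := (hA _ _).symm
    have e4 : ⟪x t, A (w t)⟫ = ⟪A (w t), x t⟫ := real_inner_comm _ _
    have e5 : ⟪w t, G t⟫ = ⟪G t, w t⟫ := real_inner_comm _ _
    simp only [hE'def, inner_add_right, inner_sub_right, inner_neg_right, inner_add_left,
      inner_sub_left, inner_smul_right, e1, e2, e3, e4, e5]
    ring
  have hwx : ∀ t, |⟪w t, x t⟫| ≤ ‖w t‖ * ‖x t‖ := fun t ↦ abs_real_inner_le_norm _ _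
  -- `E` is equivalent to `‖w‖² + ‖z‖² + ‖x‖²`: the form `w² - wx + x²/2` is positive definite.
  have hElow : ∀ t, ‖w t‖ ^ 2 + ‖z t‖ ^ 2 + ‖x t‖ ^ 2 ≤ 6 * E t := by
    intro t
    have h1 := (abs_le.1 (hwx t)).2
    have h2 := sq_nonneg (5 * ‖w t‖ - 3 * ‖x t‖)
    simp only [hEdef]
    nlinarith [sq_nonneg ‖x t‖, sq_nonneg ‖z t‖, sq_nonneg ‖w t‖]
  have hEup : ∀ t, E t ≤ 2 * (‖w t‖ ^ 2 + ‖z t‖ ^ 2 + ‖x t‖ ^ 2) := by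
    intro t
    have h1 := (abs_le.1 (hwx t)).1
    have h2 := sq_nonneg (‖w t‖ - ‖x t‖)
    simp only [hEdef]
    nlinarith [sq_nonneg ‖x t‖, sq_nonneg ‖z t‖, sq_nonneg ‖w t‖]
  have hE0 : ∀ t, 0 ≤ E t := fun t ↦ by
    have := hElow t
    have : 0 ≤ ‖w t‖ ^ 2 + ‖z t‖ ^ 2 + ‖x t‖ ^ 2 := by positivity
    linarith
  have hEc : ContinuousOn (fun t ↦ √(E t)) (Icc 0 T) :=
    ContinuousOn.sqrt (f := E) fun t ht ↦ (hE t ht).continuousWithinAt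
  have hwE : ∀ t, ‖w t‖ ≤ 3 * √(E t) := fun t ↦ by
    have := hElow t
    have h2 := Real.sq_sqrt (hE0 t)
    refine abs_le_of_sq_le_sq' ?_ (by positivity) |>.2
    nlinarith [sq_nonneg ‖x t‖, sq_nonneg ‖z t‖, hE0 t]
  have hxE : ∀ t, ‖x t‖ ≤ 3 * √(E t) := fun t ↦ by
    have := hElow t
    have h2 := Real.sq_sqrt (hE0 t)
    refine abs_le_of_sq_le_sq' ?_ (by positivity) |>.2
    nlinarith [sq_nonneg ‖w t‖, sq_nonneg ‖z t‖, hE0 t]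
  have hxz1 : ∀ t ∈ Icc 0 T, β * ‖x t‖ ≤ κ ^ 2 * α * ‖z t‖ := fun t ht ↦ by
    calc β * ‖x t‖ ≤ ‖Q (x t)‖ := hQ1 _
      _ = ‖A (z t)‖ := by rw [hxz t ht, norm_neg]
      _ ≤ _ := hA2 _
  have hxz2 : ∀ t ∈ Icc 0 T, α * ‖z t‖ ≤ κ * β * ‖x t‖ := fun t ht ↦ by
    have h1 : α * ‖z t‖ ≤ ‖A (z t)‖ := by
      rcases (norm_nonneg (z t)).eq_or_lt with h | h
      · simp [← h]
      · have h2 := (hA1 (z t)).trans (real_inner_le_norm _ _)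
        nlinarith
    calc α * ‖z t‖ ≤ ‖A (z t)‖ := h1
      _ = ‖Q (x t)‖ := by rw [hxz t ht, norm_neg]
      _ ≤ _ := hQ2 _
  have h2wx : ∀ t, ‖(2 : ℝ) • w t - x t‖ ≤ 2 * √(E t) := fun t ↦ by
    have h2 := Real.sq_sqrt (hE0 t)
    refine abs_le_of_sq_le_sq' ?_ (by positivity) |>.2
    rw [norm_sub_sq_real, norm_smul, inner_smul_left, mul_pow, mul_pow, h2]
    simp only [hEdef, Real.norm_eq_abs, conj_trivial]
    rw [abs_of_pos (by norm_num : (0 : ℝ) < 2)]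
    nlinarith [sq_nonneg ‖z t‖, sq_nonneg ‖x t‖]
  -- `E ≤ 2M(‖w‖² + ‖z‖²)`, since the constraint bounds `‖x‖` by `(κ²α/β)‖z‖`.
  set M : ℝ := 1 + (κ ^ 2 * α / β) ^ 2 with hM
  have hM0 : 0 < M := by positivity
  have hdecay : ∀ t ∈ Icc 0 T,
      E' t ≤ -(2 * (α / (4 * M))) * E t + 2 * ‖G t‖ * √(E t) := by
    intro t ht
    have h1 : ⟪G t, (2 : ℝ) • w t - x t⟫ ≤ 2 * ‖G t‖ * √(E t) := by
      refine (real_inner_le_norm _ _).trans ?_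
      have := mul_le_mul_of_nonneg_left (h2wx t) (norm_nonneg (G t))
      linarith
    have h2 : ‖x t‖ ^ 2 ≤ (κ ^ 2 * α / β) ^ 2 * ‖z t‖ ^ 2 := by
      rw [← mul_pow]
      refine pow_le_pow_left₀ (norm_nonneg _) ?_ 2
      rw [div_mul_eq_mul_div, le_div_iff₀ hβ]
      linarith [hxz1 t ht]
    have h3 : E t ≤ 2 * M * (‖w t‖ ^ 2 + ‖z t‖ ^ 2) := by
      have h4 : 0 ≤ (κ ^ 2 * α / β) ^ 2 * ‖w t‖ ^ 2 := by positivity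
      have := hEup t
      rw [hM]
      nlinarith
    have h5 : 2 * (α / (4 * M)) * E t ≤ α * (‖w t‖ ^ 2 + ‖z t‖ ^ 2) := by
      have e : 2 * (α / (4 * M)) * E t = α * (E t / (2 * M)) := by
        field_simp
        ring
      rw [e]
      refine mul_le_mul_of_nonneg_left ?_ hα.le
      rw [div_le_iff₀ (by positivity)]
      linarith
    have h6 := hA1 (w t)
    have h7 := hA1 (z t)
    simp only [hE'def]
    linarith
  set J := ∫ t in (0 : ℝ)..T, √(E t) with hJ
  have hJ0 : 0 ≤ J := intervalIntegral.integral_nonneg hT fun t _ ↦ Real.sqrt_nonneg _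
  set I := ∫ t in (0 : ℝ)..T, ‖G t‖ with hI
  have hI0 : 0 ≤ I := intervalIntegral.integral_nonneg hT fun t _ ↦ norm_nonneg _
  set N := ‖w 0‖ + ‖z 0‖ + ‖x 0‖ with hN
  have hN0 : 0 ≤ N := by positivity
  have hJle : α / (4 * M) * J ≤ 2 * (N + I) := by
    have h1 := integral_sqrt_le_of_deriv_le hT (by positivity : 0 ≤ α / (4 * M)) hE
      (fun t _ ↦ hE0 t) hG.norm (fun t _ ↦ norm_nonneg _) hdecay
    have h2 : √(E 0) ≤ 2 * N := by
      refine Real.sqrt_le_iff.2 ⟨by positivity, ?_⟩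
      have := hEup 0
      rw [hN]
      have a := norm_nonneg (w 0)
      have b := norm_nonneg (z 0)
      have c := norm_nonneg (x 0)
      nlinarith [mul_nonneg a b, mul_nonneg a c, mul_nonneg b c]
    linarith
  have hαJ : α * J ≤ 8 * M * (N + I) := by
    have e : α / (4 * M) * J = α * J / (4 * M) := by ring
    rw [e, div_le_iff₀ (by positivity)] at hJle
    linarith
  have hκ2 : 0 ≤ κ ^ 2 * (1 + κ ^ 4) * (N + I) := by positivity
  have hκ4 : 0 ≤ (1 + κ ^ 4) * (N + I) := by positivity
  rcases le_total α β with hαβ | hαβ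
  · -- The oscillating regime: the energy itself decays at the parabolic rate `α`.
    have h1 : ∫ t in (0 : ℝ)..T, ‖w t‖ ≤ 3 * J := by
      rw [hJ, ← intervalIntegral.integral_const_mul]
      exact intervalIntegral.integral_mono_on hT (hint _ hwc.norm)
        (hint _ (continuousOn_const.mul hEc)) fun t _ ↦ hwE t
    have h2 : M ≤ 1 + κ ^ 4 := by
      have : κ ^ 2 * α / β ≤ κ ^ 2 := by
        rw [div_le_iff₀ hβ]
        exact mul_le_mul_of_nonneg_left hαβ (sq_nonneg κ)
      have := pow_le_pow_left₀ (by positivity) this 2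
      rw [hM]
      nlinarith
    have h3 := mul_le_mul_of_nonneg_left h1 hα.le
    have h4 := mul_le_mul_of_nonneg_right h2 (by positivity : 0 ≤ N + I)
    nlinarith
  · -- The overdamped regime: the energy decays slowly, but controls `Q z` in `L¹` in time, and
    -- `w` solves a heat equation with source `G + Q z`.
    have hβ2 : β ^ 2 * M ≤ α ^ 2 * (1 + κ ^ 4) := by
      have e : β ^ 2 * M = β ^ 2 + κ ^ 4 * α ^ 2 := by
        rw [hM]
        field_simp
      rw [e]
      nlinarith
    have hzint : κ * β * ∫ t in (0 : ℝ)..T, ‖z t‖ ≤ 24 * κ ^ 2 * (1 + κ ^ 4) * (N + I) := by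
      have h1 : ∫ t in (0 : ℝ)..T, ‖z t‖ ≤ (3 * κ * β / α) * J := by
        rw [hJ, ← intervalIntegral.integral_const_mul]
        refine intervalIntegral.integral_mono_on hT (hint _ hzc.norm)
          (hint _ (continuousOn_const.mul hEc)) fun t ht ↦ ?_
        have h2 := hxz2 t ht
        have h3 := mul_le_mul_of_nonneg_left (hxE t) (by positivity : 0 ≤ κ * β)
        rw [div_mul_eq_mul_div, le_div_iff₀ hα]
        linarith
      have h2 := mul_le_mul_of_nonneg_left h1 (by positivity : 0 ≤ κ * β)
      refine h2.trans ?_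
      have e : κ * β * (3 * κ * β / α * J) = 3 * κ ^ 2 * β ^ 2 * (α * J) / α ^ 2 := by
        field_simp
      rw [e, div_le_iff₀ (by positivity)]
      have h3 := mul_le_mul_of_nonneg_left hαJ (by positivity : 0 ≤ 3 * κ ^ 2 * β ^ 2)
      have h4 := mul_le_mul_of_nonneg_left hβ2 (by positivity : 0 ≤ 24 * κ ^ 2 * (N + I))
      linarith
    have hheat := integral_sqrt_le_of_deriv_le hT hα.le
      (E := fun t ↦ ‖w t‖ ^ 2) (h := fun t ↦ ‖G t‖ + κ * β * ‖z t‖)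
      (fun t ht ↦ (hw t ht).norm_sq) (fun t _ ↦ sq_nonneg _)
      (hG.norm.add (continuousOn_const.mul hzc.norm)) (fun t _ ↦ by positivity)
      (fun t ht ↦ by
        rw [Real.sqrt_sq (norm_nonneg _), inner_add_right, inner_sub_right]
        have h1 := hA1 (w t)
        rw [real_inner_comm] at h1
        have h2 := real_inner_le_norm (w t) (G t)
        have h3 := real_inner_le_norm (w t) (Q (z t))
        have h4 := mul_le_mul_of_nonneg_left (hQ2 (z t)) (norm_nonneg (w t))
        linarith)
    simp only [Real.sqrt_sq (norm_nonneg _)] at hheat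
    rw [intervalIntegral.integral_add (hint _ hG.norm)
      ((hint _ hzc.norm).const_mul (κ * β)), intervalIntegral.integral_const_mul] at hheat
    have h5 : ‖w 0‖ ≤ N := by
      have := norm_nonneg (z 0)
      have := norm_nonneg (x 0)
      linarith
    nlinarith

/-! ### Multiplication operators on `L²` -/

/-- Multiplication by a bounded function, as an operator on `L²(ℝ²)`. -/
def mulL2 (m : Plane → ℂ) (hm : MemLp m ∞ (volume : Measure Plane)) : PlaneL2 →L[ℂ] PlaneL2 :=
  (ContinuousLinearMap.lsmul ℂ ℂ).holderL volume ∞ 2 2 (hm.toLp m)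

lemma coeFn_mulL2 {m : Plane → ℂ} (hm : MemLp m ∞ (volume : Measure Plane)) (u : PlaneL2) :
    mulL2 m hm u =ᵐ[volume] fun η ↦ m η • u η := by
  have h := ContinuousLinearMap.coeFn_holder (r := 2) (ContinuousLinearMap.lsmul ℂ ℂ)
    (hm.toLp m) u
  filter_upwards [h, hm.coeFn_toLp] with η h1 h2
  simp only [mulL2, ContinuousLinearMap.holderL_apply_apply]
  rw [h1, h2]
  rfl

lemma norm_mulL2_le {m : Plane → ℂ} (hm : MemLp m ∞ (volume : Measure Plane)) {c : ℝ}
    (hc : ∀ η, ‖m η‖ ≤ c) (u : PlaneL2) : ‖mulL2 m hm u‖ ≤ c * ‖u‖ := by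
  refine Lp.norm_le_mul_norm_of_ae_le_mul ?_
  filter_upwards [coeFn_mulL2 hm u] with η h
  rw [h, norm_smul]
  exact mul_le_mul_of_nonneg_right (hc η) (norm_nonneg _)

lemma le_norm_mulL2 {m : Plane → ℂ} (hm : MemLp m ∞ (volume : Measure Plane)) {c : ℝ}
    (hc0 : 0 < c) (hc : ∀ η, c ≤ ‖m η‖) (u : PlaneL2) : c * ‖u‖ ≤ ‖mulL2 m hm u‖ := by
  have h : ‖u‖ ≤ c⁻¹ * ‖mulL2 m hm u‖ := by
    refine Lp.norm_le_mul_norm_of_ae_le_mul ?_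
    filter_upwards [coeFn_mulL2 hm u] with η h
    rw [h, norm_smul, inv_mul_eq_div, le_div_iff₀ hc0, mul_comm]
    exact mul_le_mul_of_nonneg_right (hc η) (norm_nonneg _)
  rwa [inv_mul_eq_div, le_div_iff₀ hc0, mul_comm] at h

open scoped RealInnerProductSpace

lemma real_inner_smul_left_conj (c : ℂ) (u v : Val) : ⟪c • u, v⟫ = ⟪u, starRingEnd ℂ c • v⟫ := by
  simp only [PiLp.inner_apply, Complex.inner, PiLp.smul_apply, smul_eq_mul, map_mul]
  refine Finset.sum_congr rfl fun i _ ↦ ?_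
  congr 1
  ring

/-- Multiplication by `m` and by its conjugate are adjoint for the real inner product of `L²`, hence
real symbols are symmetric and imaginary ones skew-symmetric. -/
lemma real_inner_mulL2_left {m : Plane → ℂ} (hm : MemLp m ∞ (volume : Measure Plane))
    {m' : Plane → ℂ} (hm' : MemLp m' ∞ (volume : Measure Plane))
    (h : ∀ η, starRingEnd ℂ (m η) = m' η) (u v : PlaneL2) :
    ⟪mulL2 m hm u, v⟫ = ⟪u, mulL2 m' hm' v⟫ := by
  rw [L2.inner_def, L2.inner_def]
  refine integral_congr_ae ?_
  filter_upwards [coeFn_mulL2 hm u, coeFn_mulL2 hm' v] with η h1 h2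
  rw [h1, h2, real_inner_smul_left_conj, h]

lemma le_real_inner_mulL2 {a : Plane → ℝ}
    (ha : MemLp (fun η ↦ (a η : ℂ)) ∞ (volume : Measure Plane)) {c : ℝ} (hc : ∀ η, c ≤ a η)
    (u : PlaneL2) : c * ‖u‖ ^ 2 ≤ ⟪mulL2 _ ha u, u⟫ := by
  rw [← real_inner_self_eq_norm_sq, L2.inner_def, L2.inner_def, ← integral_const_mul]
  refine integral_mono_ae ((L2.integrable_inner u u).const_mul c)
    (L2.integrable_inner (𝕜 := ℝ) (mulL2 _ ha u) u) ?_
  filter_upwards [coeFn_mulL2 ha u] with η h1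
  rw [h1, Complex.coe_smul, real_inner_smul_left]
  exact mul_le_mul_of_nonneg_right (hc η) real_inner_self_nonneg

/-! ### Frequency-localized distributions represented by `L²` functions -/

lemma toDist_injective : Function.Injective PlaneL2.toDist := by
  have h := Lp.ker_toTemperedDistributionCLM_eq_bot (F := Val) (μ := (volume : Measure Plane))
    (p := 2)
  exact LinearMap.ker_eq_bot.1 h

lemma smulLeftCLM_toDist {m : Plane → ℂ} (hm : m.HasTemperateGrowth) {q : Plane → ℂ}
    (hq : MemLp q ∞ (volume : Measure Plane)) {z : PlaneL2}
    (h : ∀ᵐ η : Plane, m η • z η = q η • z η) :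
    TemperedDistribution.smulLeftCLM Val m (PlaneL2.toDist z) = PlaneL2.toDist (mulL2 q hq z) := by
  ext ψ : 1
  rw [TemperedDistribution.smulLeftCLM_apply_apply]
  simp only [PlaneL2.toDist, Lp.toTemperedDistribution_apply]
  refine integral_congr_ae ?_
  filter_upwards [h, coeFn_mulL2 hq z] with η h1 h2
  rw [h2, ← h1, SchwartzMap.smulLeftCLM_apply_apply hm, smul_eq_mul, mul_comm, mul_smul]

/-- A representative of `σ v` vanishes where `σ` does, up to the boundary. -/
lemma ae_eq_zero_of_smulLeftCLM_eq {σ : Plane → ℂ} (hσ : σ.HasTemperateGrowth) {B : Set Plane}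
    (hB : IsClosed B) (hσB : ∀ η ∉ B, σ η = 0) {v : 𝓢'(Plane, Val)} {z : PlaneL2}
    (h : TemperedDistribution.smulLeftCLM Val σ v = PlaneL2.toDist z) :
    ∀ᵐ η : Plane, η ∉ B → z η = 0 := by
  refine hB.isOpen_compl.ae_eq_zero_of_integral_contDiff_smul_eq_zero
    (((Lp.memLp z).locallyIntegrable (by norm_num)).locallyIntegrableOn _) ?_
  intro g g_smooth g_cpt g_supp
  have hg₁ : HasCompactSupport (Complex.ofRealCLM ∘ g) := g_cpt.comp_left rfl
  have hg₂ : ContDiff ℝ ∞ (Complex.ofRealCLM ∘ g) := by fun_prop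
  have h1 : SchwartzMap.smulLeftCLM ℂ σ (hg₁.toSchwartzMap hg₂) = 0 := by
    ext η
    rw [SchwartzMap.smulLeftCLM_apply_apply hσ]
    by_cases hη : η ∈ B
    · have : g η = 0 := by
        by_contra h0
        exact g_supp (subset_tsupport g h0) hη
      simp [this]
    · simp [hσB η hη]
  have h2 := congrArg (fun d : 𝓢'(Plane, Val) ↦ d (hg₁.toSchwartzMap hg₂)) h
  simp only [TemperedDistribution.smulLeftCLM_apply_apply, h1, map_zero] at h2
  simpa [PlaneL2.toDist] using h2.symm

/-- On a distribution localized by `σ`, an unbounded symbol `m` acts as any bounded symbol `q` which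
agrees with it on the region `B` where `σ` lives. -/
lemma smulLeftCLM_smulLeftCLM_of_eq {σ : Plane → ℂ} (hσ : σ.HasTemperateGrowth) {B : Set Plane}
    (hB : IsClosed B) (hσB : ∀ η ∉ B, σ η = 0) {v : 𝓢'(Plane, Val)} {z : PlaneL2}
    (h : TemperedDistribution.smulLeftCLM Val σ v = PlaneL2.toDist z)
    {m q : Plane → ℂ} (hm : m.HasTemperateGrowth) (hq : MemLp q ∞ (volume : Measure Plane))
    (hmq : ∀ η ∈ B, m η = q η) :
    TemperedDistribution.smulLeftCLM Val σ (TemperedDistribution.smulLeftCLM Val m v) =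
      PlaneL2.toDist (mulL2 q hq z) := by
  rw [TemperedDistribution.smulLeftCLM_smulLeftCLM_apply hm hσ, mul_comm,
    ← TemperedDistribution.smulLeftCLM_smulLeftCLM_apply hσ hm, h]
  refine smulLeftCLM_toDist hm hq ?_
  filter_upwards [ae_eq_zero_of_smulLeftCLM_eq hσ hB hσB h] with η hη
  by_cases hηB : η ∈ B
  · rw [hmq η hηB]
  · rw [hη hηB, smul_zero, smul_zero]

lemma distLpNorm_two_toDist (g : PlaneL2) : distLpNorm 2 (PlaneL2.toDist g) = ‖g‖ₑ := by
  refine le_antisymm (iInf_le_of_le g (iInf_le_of_le rfl le_rfl)) (le_iInf₂ fun g' h ↦ ?_)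
  rw [toDist_injective h]

lemma exists_toDist_eq_of_distLpNorm_ne_top {u : 𝓢'(Plane, Val)} (h : distLpNorm 2 u ≠ ⊤) :
    ∃ g : PlaneL2, PlaneL2.toDist g = u := by
  by_contra! hg
  refine h ?_
  exact iInf_eq_top.2 fun g ↦ iInf_eq_top.2 fun hgu ↦ absurd hgu (hg g)

lemma fourier_toDist (u : PlaneL2) : 𝓕 (PlaneL2.toDist u) = PlaneL2.toDist (𝓕 u) :=
  Lp.fourier_toTemperedDistribution_eq u

lemma fourierInv_toDist (u : PlaneL2) : 𝓕⁻ (PlaneL2.toDist u) = PlaneL2.toDist (𝓕⁻ u) :=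
  Lp.fourierInv_toTemperedDistribution_eq u

/-! ### Dyadic blocks on the Fourier side -/

/-- The symbol of `Δ_j Δ_k^h`. -/
def blockSymbol (φ : ℝ → ℝ) (j k : ℤ) (η : Plane) : ℂ := horSymbol φ k η * isoSymbol φ j η

/-- The Fourier transform of `Δ_j Δ_k^h u`. -/
def fourierBlock (φ : ℝ → ℝ) (j k : ℤ) (u : 𝓢'(Plane, Val)) : 𝓢'(Plane, Val) :=
  TemperedDistribution.smulLeftCLM Val (blockSymbol φ j k) (𝓕 u)

lemma IsDyadicProfile.blockSymbol_hasTemperateGrowth {φ : ℝ → ℝ} (hφ : IsDyadicProfile φ)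
    (j k : ℤ) : (blockSymbol φ j k).HasTemperateGrowth :=
  (hφ.horSymbol_hasTemperateGrowth k).mul (hφ.isoSymbol_hasTemperateGrowth j)

lemma isoBlock_horBlock {φ : ℝ → ℝ} (hφ : IsDyadicProfile φ) (j k : ℤ) (u : 𝓢'(Plane, Val)) :
    isoBlock φ j (horBlock φ k u) = 𝓕⁻ (fourierBlock φ j k u) := by
  rw [isoBlock, horBlock, TemperedDistribution.fourierMultiplierCLM_fourierMultiplierCLM_apply
    (hφ.horSymbol_hasTemperateGrowth k) (hφ.isoSymbol_hasTemperateGrowth j)]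
  rfl

lemma distLpNorm_block {φ : ℝ → ℝ} (hφ : IsDyadicProfile φ) {j k : ℤ} {u : 𝓢'(Plane, Val)}
    {z : PlaneL2} (h : fourierBlock φ j k u = PlaneL2.toDist z) :
    distLpNorm 2 (isoBlock φ j (horBlock φ k u)) = ‖z‖ₑ := by
  rw [isoBlock_horBlock hφ, h, fourierInv_toDist, distLpNorm_two_toDist]
  exact congrArg ENNReal.ofNNReal
    (Subtype.ext ((Lp.fourierTransformₗᵢ Plane Val).symm.norm_map z))

lemma exists_fourierBlock_eq {φ : ℝ → ℝ} (hφ : IsDyadicProfile φ) {j k : ℤ}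
    {u : 𝓢'(Plane, Val)} (h : distLpNorm 2 (isoBlock φ j (horBlock φ k u)) ≠ ⊤) :
    ∃ z : PlaneL2, fourierBlock φ j k u = PlaneL2.toDist z := by
  obtain ⟨g, hg⟩ := exists_toDist_eq_of_distLpNorm_ne_top h
  refine ⟨𝓕 g, ?_⟩
  rw [← fourier_toDist, hg, isoBlock_horBlock hφ, FourierTransform.fourier_fourierInv_eq]

/-- The closed region of frequencies on which `Δ_j Δ_k^h` lives. -/
def blockRegion (j k : ℤ) : Set Plane :=
  {η | 2 * Real.pi * ‖η‖ ∈ Icc (3 / 4 * (2 : ℝ) ^ j) (8 / 3 * (2 : ℝ) ^ j) ∧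
    2 * Real.pi * |η 0| ∈ Icc (3 / 4 * (2 : ℝ) ^ k) (8 / 3 * (2 : ℝ) ^ k)}

lemma isClosed_blockRegion (j k : ℤ) : IsClosed (blockRegion j k) := by
  refine IsClosed.inter ?_ ?_
  · exact isClosed_Icc.preimage (by fun_prop : Continuous fun η : Plane ↦ 2 * Real.pi * ‖η‖)
  · exact isClosed_Icc.preimage (by fun_prop : Continuous fun η : Plane ↦ 2 * Real.pi * |η 0|)

lemma IsDyadicProfile.mem_Icc_of_ne_zero {φ : ℝ → ℝ} (hφ : IsDyadicProfile φ) {j : ℤ} {τ : ℝ}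
    (h : φ ((2 : ℝ) ^ (-j) * τ) ≠ 0) : τ ∈ Icc (3 / 4 * (2 : ℝ) ^ j) (8 / 3 * (2 : ℝ) ^ j) := by
  have h1 := hφ.support_subset h
  have h2 : (0 : ℝ) < 2 ^ j := by positivity
  rw [zpow_neg, inv_mul_eq_div] at h1
  exact ⟨(le_div_iff₀ h2).1 h1.1, (div_le_iff₀ h2).1 h1.2⟩

lemma IsDyadicProfile.blockSymbol_eq_zero {φ : ℝ → ℝ} (hφ : IsDyadicProfile φ) {j k : ℤ}
    {η : Plane} (h : η ∉ blockRegion j k) : blockSymbol φ j k η = 0 := by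
  by_contra h0
  obtain ⟨h1, h2⟩ := mul_ne_zero_iff.1 h0
  exact h ⟨hφ.mem_Icc_of_ne_zero (Complex.ofReal_ne_zero.1 h2),
    hφ.mem_Icc_of_ne_zero (Complex.ofReal_ne_zero.1 h1)⟩

lemma IsDyadicProfile.memLp_blockSymbol {φ : ℝ → ℝ} (hφ : IsDyadicProfile φ) (j k : ℤ) :
    MemLp (blockSymbol φ j k) ∞ (volume : Measure Plane) := by
  have hc : Continuous φ := hφ.smooth.continuous
  have hs : HasCompactSupport φ := HasCompactSupport.of_support_subset_isCompact isCompact_Icc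
    hφ.support_subset
  obtain ⟨M, hM⟩ := hs.exists_bound_of_continuous hc
  have hσ : Continuous (blockSymbol φ j k) :=
    (hφ.blockSymbol_hasTemperateGrowth j k).1.continuous
  refine memLp_top_of_bound hσ.aestronglyMeasurable (M * M) (.of_forall fun η ↦ ?_)
  have hM0 : 0 ≤ M := (norm_nonneg _).trans (hM 0)
  rw [blockSymbol, norm_mul]
  exact mul_le_mul (by simpa [horSymbol] using hM _) (by simpa [isoSymbol] using hM _)
    (norm_nonneg _) hM0

/-- `u ↦ 𝓕(Δ_j Δ_k^h u)` on `L²`. -/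
def blockL2 {φ : ℝ → ℝ} (hφ : IsDyadicProfile φ) (j k : ℤ) : PlaneL2 →L[ℂ] PlaneL2 :=
  mulL2 _ (hφ.memLp_blockSymbol j k) ∘L
    (Lp.fourierTransformₗᵢ Plane Val).toContinuousLinearEquiv.toContinuousLinearMap

lemma fourierBlock_toDist {φ : ℝ → ℝ} (hφ : IsDyadicProfile φ) (j k : ℤ) (u : PlaneL2) :
    fourierBlock φ j k (PlaneL2.toDist u) = PlaneL2.toDist (blockL2 hφ j k u) := by
  rw [fourierBlock, fourier_toDist]
  exact smulLeftCLM_toDist (hφ.blockSymbol_hasTemperateGrowth j k) _ (.of_forall fun η ↦ rfl)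

open scoped Classical in
/-- The symbol `|ξ|²` of `-Δ` on the region of `Δ_j Δ_k^h`, extended by a constant so that it is
bounded above and below everywhere. -/
def laplaceSymbol (j k : ℤ) (η : Plane) : ℝ :=
  if η ∈ blockRegion j k then (2 * Real.pi * ‖η‖) ^ 2 else (3 / 4 * (2 : ℝ) ^ j) ^ 2

open scoped Classical in
/-- The symbol `iξ₁` of `∂₁` on the region of `Δ_j Δ_k^h`, extended by an imaginary constant so that
its modulus is bounded above and below everywhere. -/
def horDerivSymbol (j k : ℤ) (η : Plane) : ℂ :=
  (if η ∈ blockRegion j k then 2 * Real.pi * η 0 else 3 / 4 * (2 : ℝ) ^ k : ℝ) * Complex.I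

/-- The factor `32/9` is the ratio of the ends of the interval `[3/4, 8/3]`. -/
lemma laplaceSymbol_mem (j k : ℤ) (η : Plane) :
    (3 / 4 * (2 : ℝ) ^ j) ^ 2 ≤ laplaceSymbol j k η ∧
      laplaceSymbol j k η ≤ (32 / 9) ^ 2 * (3 / 4 * (2 : ℝ) ^ j) ^ 2 := by
  have h2 : (0 : ℝ) < 2 ^ j := by positivity
  unfold laplaceSymbol
  split_ifs with h
  · refine ⟨pow_le_pow_left₀ (by positivity) h.1.1 2, ?_⟩
    rw [← mul_pow]
    refine pow_le_pow_left₀ (by positivity) ?_ 2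
    linarith [h.1.2]
  · exact ⟨le_rfl, by nlinarith [sq_nonneg (3 / 4 * (2 : ℝ) ^ j)]⟩

lemma norm_horDerivSymbol_mem (j k : ℤ) (η : Plane) :
    3 / 4 * (2 : ℝ) ^ k ≤ ‖horDerivSymbol j k η‖ ∧
      ‖horDerivSymbol j k η‖ ≤ 32 / 9 * (3 / 4 * (2 : ℝ) ^ k) := by
  have h2 : (0 : ℝ) < 2 ^ k := by positivity
  unfold horDerivSymbol
  rw [norm_mul, Complex.norm_I, mul_one, Complex.norm_real, Real.norm_eq_abs]
  split_ifs with h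
  · rw [abs_mul, abs_of_pos (by positivity : 0 < 2 * Real.pi)]
    exact ⟨h.2.1, by linarith [h.2.2]⟩
  · rw [abs_of_pos (by positivity)]
    exact ⟨le_rfl, by linarith⟩

lemma memLp_laplaceSymbol (j k : ℤ) :
    MemLp (fun η ↦ (laplaceSymbol j k η : ℂ)) ∞ (volume : Measure Plane) := by
  classical
  have hm : Measurable (laplaceSymbol j k) :=
    Measurable.ite (isClosed_blockRegion j k).measurableSet
      (by fun_prop : Continuous fun η : Plane ↦ (2 * Real.pi * ‖η‖) ^ 2).measurable
      measurable_const
  refine memLp_top_of_bound (Complex.measurable_ofReal.comp hm).aestronglyMeasurable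
    ((32 / 9) ^ 2 * (3 / 4 * (2 : ℝ) ^ j) ^ 2) (.of_forall fun η ↦ ?_)
  have := laplaceSymbol_mem j k η
  rw [Complex.norm_real, Real.norm_eq_abs, abs_of_nonneg ((sq_nonneg _).trans this.1)]
  exact this.2

lemma memLp_horDerivSymbol (j k : ℤ) :
    MemLp (horDerivSymbol j k) ∞ (volume : Measure Plane) := by
  classical
  have hm : Measurable (horDerivSymbol j k) :=
    (Complex.measurable_ofReal.comp (Measurable.ite (isClosed_blockRegion j k).measurableSet
      (by fun_prop : Continuous fun η : Plane ↦ 2 * Real.pi * η 0).measurable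
      measurable_const)).mul_const _
  exact memLp_top_of_bound hm.aestronglyMeasurable _
    (.of_forall fun η ↦ (norm_horDerivSymbol_mem j k η).2)

/-- `-Δ` on the frequencies of `Δ_j Δ_k^h`. -/
def laplaceL2 (j k : ℤ) : PlaneL2 →L[ℂ] PlaneL2 := mulL2 _ (memLp_laplaceSymbol j k)

/-- `∂₁` on the frequencies of `Δ_j Δ_k^h`. -/
def horDerivL2 (j k : ℤ) : PlaneL2 →L[ℂ] PlaneL2 := mulL2 _ (memLp_horDerivSymbol j k)

lemma fourierBlock_lineDeriv {φ : ℝ → ℝ} (hφ : IsDyadicProfile φ) {j k : ℤ}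
    {u : 𝓢'(Plane, Val)} {z : PlaneL2} (h : fourierBlock φ j k u = PlaneL2.toDist z) :
    fourierBlock φ j k (∂_{unitVec 0} u) = PlaneL2.toDist (horDerivL2 j k z) := by
  have hm : (fun η : Plane ↦ ((inner ℝ η (unitVec 0) : ℝ) : ℂ)).HasTemperateGrowth := by fun_prop
  have hm' : ((2 * Real.pi * Complex.I : ℂ) •
      fun η : Plane ↦ ((inner ℝ η (unitVec 0) : ℝ) : ℂ)).HasTemperateGrowth := by
    exact (Function.HasTemperateGrowth.const _).mul hm
  rw [fourierBlock, TemperedDistribution.fourier_lineDerivOp_eq,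
    ← _root_.smul_apply, ← TemperedDistribution.smulLeftCLM_smul hm]
  refine smulLeftCLM_smulLeftCLM_of_eq (hφ.blockSymbol_hasTemperateGrowth j k)
    (isClosed_blockRegion j k) (fun η ↦ hφ.blockSymbol_eq_zero) h hm' _ fun η hη ↦ ?_
  simp only [horDerivSymbol, if_pos hη, unitVec, Pi.smul_apply, smul_eq_mul,
    EuclideanSpace.inner_single_right]
  push_cast
  simp
  ring

lemma fourierBlock_laplacian {φ : ℝ → ℝ} (hφ : IsDyadicProfile φ) {j k : ℤ}
    {u : 𝓢'(Plane, Val)} {z : PlaneL2} (h : fourierBlock φ j k u = PlaneL2.toDist z) :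
    fourierBlock φ j k (Δ u) = PlaneL2.toDist (-laplaceL2 j k z) := by
  have hm : (fun η : Plane ↦ ((‖η‖ ^ 2 : ℝ) : ℂ)).HasTemperateGrowth := by fun_prop
  have hm' : (((-(2 * Real.pi) ^ 2 : ℝ) : ℂ) •
      fun η : Plane ↦ ((‖η‖ ^ 2 : ℝ) : ℂ)).HasTemperateGrowth := by
    exact (Function.HasTemperateGrowth.const _).mul hm
  have e : 𝓕 (Δ u) = TemperedDistribution.smulLeftCLM Val
      (((-(2 * Real.pi) ^ 2 : ℝ) : ℂ) • fun η : Plane ↦ ((‖η‖ ^ 2 : ℝ) : ℂ)) (𝓕 u) := by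
    rw [TemperedDistribution.laplacian_eq_fourierMultiplierCLM,
      TemperedDistribution.fourierMultiplierCLM_apply, ← Complex.coe_smul,
      FourierTransform.fourier_smul, FourierTransform.fourier_fourierInv_eq,
      TemperedDistribution.smulLeftCLM_smul hm, _root_.smul_apply]
  have hn : MemLp (fun η ↦ -(laplaceSymbol j k η : ℂ)) ∞ (volume : Measure Plane) :=
    (memLp_laplaceSymbol j k).neg
  have e2 : mulL2 _ hn z = -laplaceL2 j k z := by
    refine Lp.ext ?_
    filter_upwards [coeFn_mulL2 hn z, coeFn_mulL2 (memLp_laplaceSymbol j k) z,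
      Lp.coeFn_neg (laplaceL2 j k z)] with η h1 h2 h3
    rw [h1, h3, Pi.neg_apply, laplaceL2, h2, neg_smul]
  rw [fourierBlock, e, ← e2]
  refine smulLeftCLM_smulLeftCLM_of_eq (hφ.blockSymbol_hasTemperateGrowth j k)
    (isClosed_blockRegion j k) (fun η ↦ hφ.blockSymbol_eq_zero) h hm' _ fun η hη ↦ ?_
  simp only [laplaceSymbol, if_pos hη, Pi.smul_apply, smul_eq_mul]
  push_cast
  ring

/-! ### The estimate of one dyadic block of a solution -/

lemma mulL2_comm {m q : Plane → ℂ} (hm : MemLp m ∞ (volume : Measure Plane))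
    (hq : MemLp q ∞ (volume : Measure Plane)) (u : PlaneL2) :
    mulL2 m hm (mulL2 q hq u) = mulL2 q hq (mulL2 m hm u) := by
  refine Lp.ext ?_
  filter_upwards [coeFn_mulL2 hm (mulL2 q hq u), coeFn_mulL2 hq (mulL2 m hm u),
    coeFn_mulL2 hm u, coeFn_mulL2 hq u] with η h1 h2 h3 h4
  rw [h1, h2, h3, h4, smul_comm]

lemma fourierBlock_add (φ : ℝ → ℝ) (j k : ℤ) (u v : 𝓢'(Plane, Val)) :
    fourierBlock φ j k (u + v) = fourierBlock φ j k u + fourierBlock φ j k v := by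
  simp only [fourierBlock, FourierTransform.fourier_add, map_add]

lemma fourierBlock_sub (φ : ℝ → ℝ) (j k : ℤ) (u v : 𝓢'(Plane, Val)) :
    fourierBlock φ j k (u - v) = fourierBlock φ j k u - fourierBlock φ j k v := by
  have h : 𝓕 (u - v) = 𝓕 u - 𝓕 v := map_sub (FourierTransform.fourierCLM ℂ 𝓢'(Plane, Val)) u v
  rw [fourierBlock, h, map_sub]
  rfl

lemma toDist_add (u v : PlaneL2) :
    PlaneL2.toDist (u + v) = PlaneL2.toDist u + PlaneL2.toDist v :=
  map_add (Lp.toTemperedDistributionCLM Val (volume : Measure Plane) 2) u v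

lemma toDist_sub (u v : PlaneL2) :
    PlaneL2.toDist (u - v) = PlaneL2.toDist u - PlaneL2.toDist v :=
  map_sub (Lp.toTemperedDistributionCLM Val (volume : Measure Plane) 2) u v

lemma lineDeriv_laplacian_comm (m : Plane) (u : 𝓢'(Plane, Val)) :
    ∂_{m} (Δ u) = Δ (∂_{m} u) := by
  have h1 : (fun η : Plane ↦ ((inner ℝ η m : ℝ) : ℂ)).HasTemperateGrowth := by fun_prop
  have h2 : (fun η : Plane ↦ ((‖η‖ ^ 2 : ℝ) : ℂ)).HasTemperateGrowth := by fun_prop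
  simp only [TemperedDistribution.lineDeriv_eq_fourierMultiplierCLM,
    TemperedDistribution.laplacian_eq_fourierMultiplierCLM, ← Complex.coe_smul, map_smul]
  rw [TemperedDistribution.fourierMultiplierCLM_fourierMultiplierCLM_apply h1 h2,
    TemperedDistribution.fourierMultiplierCLM_fourierMultiplierCLM_apply h2 h1, smul_comm]
  congr 3
  rw [mul_comm]


/-- `L²` functions tested against a fixed Schwartz function. -/
def testL2 (ψ : 𝓢(Plane, ℂ)) : PlaneL2 →L[ℂ] Val :=
  PointwiseConvergenceCLM.evalCLM (RingHom.id ℂ) Val ψ ∘L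
    Lp.toTemperedDistributionCLM Val (volume : Measure Plane) 2

/-- A solution differs from its initial value by the `L²`-valued primitive of `Y_t`. -/
lemma IsSolution.exists_primitive {T : ℝ} (hT : 0 < T) {f Y : ℝ → 𝓢'(Plane, Val)}
    {Yt : ℝ → PlaneL2} {Y₀ : 𝓢'(Plane, Val)} {Y₁ : PlaneL2} (h : IsSolution T f Y Yt Y₀ Y₁) :
    ∃ D : ℝ → PlaneL2, D 0 = 0 ∧ (∀ t ∈ Icc 0 T, HasDerivWithinAt D (Yt t) (Icc 0 T) t) ∧
      ∀ t ∈ Icc 0 T, Y t = Y₀ + PlaneL2.toDist (D t) := by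
  set g : ℝ → PlaneL2 := fun t ↦ Yt (projIcc 0 T hT.le t) with hg
  have hgc : Continuous g :=
    (continuousOn_iff_continuous_domRestrict.1 h.contDiffOn.continuousOn).comp continuous_projIcc
  have hgt : ∀ t ∈ Icc 0 T, g t = Yt t := fun t ht ↦ by rw [hg]; simp [projIcc_of_mem hT.le ht]
  have hD : ∀ t ∈ Icc 0 T,
      HasDerivWithinAt (fun s ↦ ∫ r in (0 : ℝ)..s, g r) (Yt t) (Icc 0 T) t := fun t ht ↦ by
    rw [← hgt t ht]
    exact (hgc.integral_hasStrictDerivAt 0 t).hasDerivAt.hasDerivWithinAt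
  refine ⟨fun s ↦ ∫ r in (0 : ℝ)..s, g r, by simp, hD, fun t ht ↦ ?_⟩
  ext ψ : 1
  have hdiff : ∀ s ∈ Icc 0 T, HasDerivWithinAt
      (fun s ↦ Y s ψ - testL2 ψ (∫ r in (0 : ℝ)..s, g r)) 0 (Icc 0 T) s := fun s hs ↦ by
    have h1 := h.hasDeriv s hs ψ
    have h2 := ((testL2 ψ).restrictScalars ℝ).hasFDerivAt.comp_hasDerivWithinAt s (hD s hs)
    exact (h1.sub h2).congr_deriv (sub_self _)
  have hconst := constant_of_derivWithin_zero
    (fun s hs ↦ (hdiff s hs).differentiableWithinAt)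
    (fun s hs ↦ (hdiff s (Ico_subset_Icc_self hs)).derivWithin
      (uniqueDiffOn_Icc hT s (Ico_subset_Icc_self hs))) t ht
  simp only [intervalIntegral.integral_same, map_zero, sub_zero, h.initial] at hconst
  rw [sub_eq_iff_eq_add] at hconst
  exact hconst

/-- The estimate of a single block: the frequency-localized equation is a damped system to which
`integral_norm_le_of_damped_system` applies, with `α ∼ 4^j` and `β ∼ 2^k`. -/
theorem IsSolution.integral_norm_blockL2_le {φ : ℝ → ℝ} (hφ : IsDyadicProfile φ) (j k : ℤ) {T : ℝ}
    (hT : 0 < T) {f Y : ℝ → 𝓢'(Plane, Val)} {Yt : ℝ → PlaneL2} {Y₀ : 𝓢'(Plane, Val)}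
    {Y₁ : PlaneL2} (h : IsSolution T f Y Yt Y₀ Y₁) {z₀ x₀ : PlaneL2}
    (hz₀ : fourierBlock φ j k (∂_{unitVec 0} Y₀) = PlaneL2.toDist z₀)
    (hx₀ : fourierBlock φ j k (Δ Y₀) = PlaneL2.toDist x₀) :
    ∃ G : ℝ → PlaneL2, ContinuousOn G (Icc 0 T) ∧
      (∀ t ∈ Icc 0 T, fourierBlock φ j k (f t) = PlaneL2.toDist (G t)) ∧
      (3 / 4 * (2 : ℝ) ^ j) ^ 2 * ∫ t in (0 : ℝ)..T, ‖blockL2 hφ j k (Yt t)‖ ≤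
        (1 + 24 * (1 + (32 / 9) ^ 2) * (1 + (32 / 9) ^ 4)) *
          (‖blockL2 hφ j k Y₁‖ + ‖z₀‖ + ‖x₀‖ + ∫ t in (0 : ℝ)..T, ‖G t‖) := by
  obtain ⟨D, hD0, hD, hYD⟩ := h.exists_primitive hT
  set S := blockL2 hφ j k with hS
  set A := laplaceL2 j k with hA
  set Q := horDerivL2 j k with hQ
  set Y' := derivWithin Yt (Icc 0 T) with hY'
  have hYt : ∀ t ∈ Icc 0 T, HasDerivWithinAt Yt (Y' t) (Icc 0 T) t := fun t ht ↦
    (h.contDiffOn.differentiableOn (by norm_num) t ht).hasDerivWithinAt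
  have hY'c : ContinuousOn Y' (Icc 0 T) :=
    h.contDiffOn.continuousOn_derivWithin (uniqueDiffOn_Icc hT) (by norm_num)
  have hYtc : ContinuousOn Yt (Icc 0 T) := h.contDiffOn.continuousOn
  have hDc : ContinuousOn D (Icc 0 T) := fun t ht ↦ (hD t ht).continuousWithinAt
  -- the derivative of a bounded complex-linear image of a curve
  have hcomp : ∀ (L : PlaneL2 →L[ℂ] PlaneL2) {g : ℝ → PlaneL2} {g' : PlaneL2} {t : ℝ},
      HasDerivWithinAt g g' (Icc 0 T) t →
      HasDerivWithinAt (fun s ↦ L (g s)) (L g') (Icc 0 T) t := fun L g g' t hg ↦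
    (L.restrictScalars ℝ).hasFDerivAt.comp_hasDerivWithinAt t hg
  set w : ℝ → PlaneL2 := fun t ↦ S (Yt t) with hw
  set z : ℝ → PlaneL2 := fun t ↦ z₀ + Q (S (D t)) with hz
  set x : ℝ → PlaneL2 := fun t ↦ x₀ - A (S (D t)) with hx
  set G : ℝ → PlaneL2 := fun t ↦ S (Y' t) + A (w t) - Q (z t) with hG
  -- `∂₁ΔY₀ = Δ∂₁Y₀`
  have hxz₀ : Q x₀ = -A z₀ := by
    have h1 := fourierBlock_lineDeriv hφ hx₀
    rw [lineDeriv_laplacian_comm, fourierBlock_laplacian hφ hz₀] at h1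
    exact (toDist_injective h1).symm
  have hf : ∀ t ∈ Icc 0 T, fourierBlock φ j k (f t) = PlaneL2.toDist (G t) := fun t ht ↦ by
    have h1 : fourierBlock φ j k (∂_{unitVec 0} (Y t)) = PlaneL2.toDist (z t) := by
      rw [hYD t ht, LineDeriv.lineDerivOp_add, fourierBlock_add, hz₀,
        fourierBlock_lineDeriv hφ (fourierBlock_toDist hφ j k (D t)), toDist_add]
    rw [← h.equation t ht, fourierBlock_sub, fourierBlock_sub, fourierBlock_lineDeriv hφ h1,
      fourierBlock_laplacian hφ (fourierBlock_toDist hφ j k (Yt t)), fourierBlock_toDist hφ,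
      ← toDist_sub, ← toDist_sub, sub_neg_eq_add]
  have hGc : ContinuousOn G (Icc 0 T) := by
    have h1 := S.continuous.comp_continuousOn hY'c
    have h2 := A.continuous.comp_continuousOn (S.continuous.comp_continuousOn hYtc)
    have h3 := Q.continuous.comp_continuousOn ((continuousOn_const (c := z₀)).add
      (Q.continuous.comp_continuousOn (S.continuous.comp_continuousOn hDc)))
    exact (h1.add h2).sub h3
  refine ⟨G, hGc, hf, ?_⟩
  have h2j : (0 : ℝ) < 2 ^ j := by positivity
  have h2k : (0 : ℝ) < 2 ^ k := by positivity
  have hmain := integral_norm_le_of_damped_system (H := PlaneL2)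
    (A.restrictScalars ℝ) (Q.restrictScalars ℝ)
    (α := (3 / 4 * (2 : ℝ) ^ j) ^ 2) (β := 3 / 4 * (2 : ℝ) ^ k) (κ := 32 / 9)
    (fun u v ↦ real_inner_mulL2_left (memLp_laplaceSymbol j k) (memLp_laplaceSymbol j k)
      (fun η ↦ Complex.conj_ofReal _) u v)
    (fun u v ↦ by
      have hn : MemLp (fun η ↦ -horDerivSymbol j k η) ∞ (volume : Measure Plane) :=
        (memLp_horDerivSymbol j k).neg
      have e : mulL2 _ hn v = -Q v := by
        refine Lp.ext ?_
        filter_upwards [coeFn_mulL2 hn v, coeFn_mulL2 (memLp_horDerivSymbol j k) v,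
          Lp.coeFn_neg (Q v)] with η h1 h2 h3
        rw [h1, h3, Pi.neg_apply, hQ, horDerivL2, h2, neg_smul]
      rw [← inner_neg_right]
      change inner ℝ (Q u) v = inner ℝ u (-Q v)
      rw [← e]
      exact real_inner_mulL2_left (memLp_horDerivSymbol j k) hn
        (fun η ↦ by simp [horDerivSymbol]) u v)
    (by positivity) (by positivity) (by norm_num)
    (fun u ↦ le_real_inner_mulL2 (memLp_laplaceSymbol j k)
      (fun η ↦ (laplaceSymbol_mem j k η).1) u)
    (fun u ↦ norm_mulL2_le (memLp_laplaceSymbol j k) (fun η ↦ by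
      have := laplaceSymbol_mem j k η
      rw [Complex.norm_real, Real.norm_eq_abs, abs_of_nonneg ((sq_nonneg _).trans this.1)]
      exact this.2) u)
    (fun u ↦ le_norm_mulL2 (memLp_horDerivSymbol j k) (by positivity)
      (fun η ↦ (norm_horDerivSymbol_mem j k η).1) u)
    (fun u ↦ norm_mulL2_le (memLp_horDerivSymbol j k)
      (fun η ↦ (norm_horDerivSymbol_mem j k η).2) u)
    hT.le (w := w) (z := z) (x := x) (G := G)
    (fun t ht ↦ (hcomp S (hYt t ht)).congr_deriv (by
      change S (Y' t) = S (Y' t) + A (w t) - Q (z t) - A (w t) + Q (z t)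
      abel))
    (fun t ht ↦ (hcomp Q (hcomp S (hD t ht))).const_add z₀)
    (fun t ht ↦ ((hcomp A (hcomp S (hD t ht))).const_sub x₀))
    hGc (fun t _ ↦ by
      change Q (x₀ - A (S (D t))) = -A (z₀ + Q (S (D t)))
      rw [map_sub, map_add, hxz₀, hQ, hA, horDerivL2, laplaceL2, mulL2_comm]
      abel)
  have e1 : z 0 = z₀ := by simp [hz, hD0]
  have e2 : x 0 = x₀ := by simp [hx, hD0]
  have e3 : w 0 = S Y₁ := by simp [hw, h.initial_deriv]
  rwa [e1, e2, e3] at hmain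

/-! ### Summation over the blocks -/

/-- The constant of the a priori estimate. -/
def aprioriConst : ℝ≥0 := 2 * (16 / 9) * (1 + 24 * (1 + (32 / 9) ^ 2) * (1 + (32 / 9) ^ 4))

lemma aprioriConst_ne_zero : (aprioriConst : ℝ≥0∞) ≠ 0 := by
  have : aprioriConst ≠ 0 := by unfold aprioriConst; positivity
  exact_mod_cast this

lemma two_rpow_ne_zero (x : ℝ) : (2 : ℝ≥0∞) ^ x ≠ 0 :=
  (ENNReal.rpow_pos (by norm_num) (by norm_num)).ne'

lemma two_rpow_ne_top (x : ℝ) : (2 : ℝ≥0∞) ^ x ≠ ⊤ :=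
  ENNReal.rpow_ne_top_of_ne_zero (by norm_num) (by norm_num)

lemma two_rpow_mul_two_rpow (x y : ℝ) : (2 : ℝ≥0∞) ^ x * (2 : ℝ≥0∞) ^ y = 2 ^ (x + y) :=
  (ENNReal.rpow_add x y (by norm_num) (by norm_num)).symm

/-- Since `|ξ₁| ≤ |ξ|`, a non-zero block has `2^k ≲ 2^j`. -/
lemma le_add_two_of_nonempty_blockRegion {j k : ℤ} (h : (blockRegion j k).Nonempty) :
    k ≤ j + 2 := by
  by_contra! hlt
  obtain ⟨η, h1, h2⟩ := h
  have h3 : |η 0| ≤ ‖η‖ := by simpa using PiLp.norm_apply_le η 0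
  have h4 : 2 * Real.pi * |η 0| ≤ 2 * Real.pi * ‖η‖ := by gcongr
  have h5 : (2 : ℝ) ^ (j + 3) ≤ 2 ^ k := zpow_le_zpow_right₀ (by norm_num) (by lia)
  rw [zpow_add₀ (by norm_num)] at h5
  norm_num at h5
  have h6 : (0 : ℝ) < 2 ^ j := by positivity
  linarith [h1.2, h2.1]

lemma blockL2_eq_zero {φ : ℝ → ℝ} (hφ : IsDyadicProfile φ) {j k : ℤ}
    (h : ¬(blockRegion j k).Nonempty) (u : PlaneL2) : blockL2 hφ j k u = 0 := by
  refine (Lp.eq_zero_iff_ae_eq_zero).2 ?_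
  filter_upwards [coeFn_mulL2 (hφ.memLp_blockSymbol j k) (𝓕 u)] with η h1
  refine h1.trans ?_
  rw [hφ.blockSymbol_eq_zero fun hη ↦ h ⟨η, hη⟩, zero_smul]
  rfl

lemma distLpNorm_block_toDist {φ : ℝ → ℝ} (hφ : IsDyadicProfile φ) (j k : ℤ) (u : PlaneL2) :
    distLpNorm 2 (isoBlock φ j (horBlock φ k (PlaneL2.toDist u))) = ‖blockL2 hφ j k u‖ₑ :=
  distLpNorm_block hφ (fourierBlock_toDist hφ j k u)

lemma lintegral_Icc_enorm_eq {T : ℝ} (hT : 0 ≤ T) {g : ℝ → PlaneL2}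
    (hg : ContinuousOn g (Icc 0 T)) :
    ∫⁻ t in Icc 0 T, ‖g t‖ₑ = ENNReal.ofReal (∫ t in (0 : ℝ)..T, ‖g t‖) := by
  rw [intervalIntegral.integral_of_le hT, ← integral_Icc_eq_integral_Ioc,
    ofReal_integral_norm_eq_lintegral_enorm hg.integrableOn_Icc]

/-- The contribution of one block to the a priori estimate.  No finiteness is assumed: a block of
`∂₁Y₀` or `ΔY₀` which is not in `L²` makes the right-hand side infinite. -/
theorem IsSolution.lintegral_block_le {φ : ℝ → ℝ} (hφ : IsDyadicProfile φ) (j k : ℤ) {T : ℝ}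
    (hT : 0 < T) {f Y : ℝ → 𝓢'(Plane, Val)} {Yt : ℝ → PlaneL2} {Y₀ : 𝓢'(Plane, Val)}
    {Y₁ : PlaneL2} (h : IsSolution T f Y Yt Y₀ Y₁) :
    ∫⁻ t in Icc 0 T, (2 : ℝ≥0∞) ^ ((j : ℝ) * (3 / 2)) * (2 : ℝ≥0∞) ^ ((k : ℝ) * (1 / 2)) *
        distLpNorm 2 (isoBlock φ j (horBlock φ k (PlaneL2.toDist (Yt t)))) ≤
      aprioriConst * ((2 : ℝ≥0∞) ^ ((j : ℝ) * (-1 / 2)) * (2 : ℝ≥0∞) ^ ((k : ℝ) * (1 / 2)) *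
          distLpNorm 2 (isoBlock φ j (horBlock φ k (PlaneL2.toDist Y₁))) +
        (2 : ℝ≥0∞) ^ ((j : ℝ) * (-1 / 2)) * (2 : ℝ≥0∞) ^ ((k : ℝ) * (1 / 2)) *
          distLpNorm 2 (isoBlock φ j (horBlock φ k (∂_{unitVec 0} Y₀))) +
        (2 : ℝ≥0∞) ^ ((j : ℝ) * (-1 / 2)) * (2 : ℝ≥0∞) ^ ((k : ℝ) * (1 / 2)) *
          distLpNorm 2 (isoBlock φ j (horBlock φ k (Δ Y₀))) +
        ∫⁻ t in Icc 0 T, (2 : ℝ≥0∞) ^ ((j : ℝ) * 0) * (2 : ℝ≥0∞) ^ ((k : ℝ) * 0) *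
          distLpNorm 2 (isoBlock φ j (horBlock φ k (f t)))) := by
  have hV0 : (2 : ℝ≥0∞) ^ ((j : ℝ) * (-1 / 2)) * (2 : ℝ≥0∞) ^ ((k : ℝ) * (1 / 2)) ≠ 0 :=
    mul_ne_zero (two_rpow_ne_zero _) (two_rpow_ne_zero _)
  by_cases hz : distLpNorm 2 (isoBlock φ j (horBlock φ k (∂_{unitVec 0} Y₀))) = ⊤
  · rw [hz, ENNReal.mul_top hV0, add_top, top_add, top_add,
      ENNReal.mul_top aprioriConst_ne_zero]
    exact le_top
  by_cases hx : distLpNorm 2 (isoBlock φ j (horBlock φ k (Δ Y₀))) = ⊤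
  · rw [hx, ENNReal.mul_top hV0, add_top, top_add, ENNReal.mul_top aprioriConst_ne_zero]
    exact le_top
  obtain ⟨z₀, hz₀⟩ := exists_fourierBlock_eq hφ hz
  obtain ⟨x₀, hx₀⟩ := exists_fourierBlock_eq hφ hx
  -- The gain `2^{(k-j)/2} ≲ 1` holds only for blocks which meet `|ξ₁| ≤ |ξ|`; the others vanish.
  by_cases hB : (blockRegion j k).Nonempty
  swap
  · simp [distLpNorm_block_toDist hφ, blockL2_eq_zero hφ hB]
  obtain ⟨G, hGc, hG, hmain⟩ := h.integral_norm_blockL2_le hφ j k hT hz₀ hx₀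
  have hwc : ContinuousOn (fun t ↦ blockL2 hφ j k (Yt t)) (Icc 0 T) :=
    (blockL2 hφ j k).continuous.comp_continuousOn h.contDiffOn.continuousOn
  have hGI : ∫⁻ t in Icc 0 T, (2 : ℝ≥0∞) ^ ((j : ℝ) * 0) * (2 : ℝ≥0∞) ^ ((k : ℝ) * 0) *
      distLpNorm 2 (isoBlock φ j (horBlock φ k (f t))) =
      ENNReal.ofReal (∫ t in (0 : ℝ)..T, ‖G t‖) := by
    rw [← lintegral_Icc_enorm_eq hT.le hGc]
    refine setLIntegral_congr_fun measurableSet_Icc fun t ht ↦ ?_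
    simp only [mul_zero, ENNReal.rpow_zero, one_mul]
    exact distLpNorm_block hφ (hG t ht)
  rw [hGI, distLpNorm_block_toDist hφ, distLpNorm_block hφ hz₀, distLpNorm_block hφ hx₀]
  simp only [distLpNorm_block_toDist hφ]
  rw [lintegral_const_mul' _ _ (ENNReal.mul_ne_top (two_rpow_ne_top _) (two_rpow_ne_top _)),
    lintegral_Icc_enorm_eq hT.le hwc]
  set I := ∫ t in (0 : ℝ)..T, ‖blockL2 hφ j k (Yt t)‖
  set J := ∫ t in (0 : ℝ)..T, ‖G t‖
  have hJ : 0 ≤ J := intervalIntegral.integral_nonneg hT.le fun t _ ↦ norm_nonneg _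
  set V := (2 : ℝ≥0∞) ^ ((j : ℝ) * (-1 / 2)) * (2 : ℝ≥0∞) ^ ((k : ℝ) * (1 / 2)) with hV
  have hV2 : V ≤ 2 := by
    rw [hV, two_rpow_mul_two_rpow]
    have hk : (k : ℝ) ≤ j + 2 := by exact_mod_cast le_add_two_of_nonempty_blockRegion hB
    calc (2 : ℝ≥0∞) ^ ((j : ℝ) * (-1 / 2) + (k : ℝ) * (1 / 2)) ≤ 2 ^ (1 : ℝ) :=
          ENNReal.rpow_le_rpow_of_exponent_le (by norm_num) (by linarith)
      _ = 2 := ENNReal.rpow_one _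
  have hW : (2 : ℝ≥0∞) ^ ((j : ℝ) * (3 / 2)) * (2 : ℝ≥0∞) ^ ((k : ℝ) * (1 / 2)) =
      V * ENNReal.ofReal (((2 : ℝ) ^ j) ^ 2) := by
    have e : ENNReal.ofReal (((2 : ℝ) ^ j) ^ 2) = (2 : ℝ≥0∞) ^ (2 * (j : ℝ)) := by
      rw [← zpow_natCast, ← zpow_mul, ← Real.rpow_intCast,
        ← ENNReal.ofReal_rpow_of_pos (by norm_num)]
      push_cast
      rw [ENNReal.ofReal_ofNat, mul_comm]
    rw [e, hV, two_rpow_mul_two_rpow, two_rpow_mul_two_rpow, two_rpow_mul_two_rpow]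
    congr 1
    ring
  have hreal : ((2 : ℝ) ^ j) ^ 2 * I ≤ (16 / 9 * (1 + 24 * (1 + (32 / 9) ^ 2) *
      (1 + (32 / 9) ^ 4))) * (‖blockL2 hφ j k Y₁‖ + ‖z₀‖ + ‖x₀‖ + J) := by
    rw [mul_pow] at hmain
    linarith
  have henn : ENNReal.ofReal (((2 : ℝ) ^ j) ^ 2) * ENNReal.ofReal I ≤
      ENNReal.ofReal (16 / 9 * (1 + 24 * (1 + (32 / 9) ^ 2) * (1 + (32 / 9) ^ 4))) *
        (‖blockL2 hφ j k Y₁‖ₑ + ‖z₀‖ₑ + ‖x₀‖ₑ + ENNReal.ofReal J) := by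
    rw [← ofReal_norm, ← ofReal_norm, ← ofReal_norm,
      ← ENNReal.ofReal_add (by positivity) (by positivity),
      ← ENNReal.ofReal_add (by positivity) (by positivity),
      ← ENNReal.ofReal_add (by positivity) hJ,
      ← ENNReal.ofReal_mul (by positivity), ← ENNReal.ofReal_mul (by positivity)]
    exact ENNReal.ofReal_le_ofReal hreal
  set K := ENNReal.ofReal (16 / 9 * (1 + 24 * (1 + (32 / 9) ^ 2) * (1 + (32 / 9) ^ 4))) with hK
  have hC : (aprioriConst : ℝ≥0∞) = K * 2 := by
    rw [hK, ← ENNReal.ofReal_ofNat 2, ← ENNReal.ofReal_mul (by positivity),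
      ← ENNReal.ofReal_coe_nnreal]
    congr 1
    unfold aprioriConst
    push_cast
    ring
  rw [hW, hC]
  set a := ‖blockL2 hφ j k Y₁‖ₑ
  set b := ‖z₀‖ₑ
  set c := ‖x₀‖ₑ
  calc V * ENNReal.ofReal (((2 : ℝ) ^ j) ^ 2) * ENNReal.ofReal I
      ≤ V * (K * (a + b + c + ENNReal.ofReal J)) := by
        rw [mul_assoc]
        gcongr
    _ = K * (V * a + V * b + V * c + V * ENNReal.ofReal J) := by ring
    _ ≤ K * (2 * (V * a) + 2 * (V * b) + 2 * (V * c) + 2 * ENNReal.ofReal J) := by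
        have h2 : ∀ y : ℝ≥0∞, y ≤ 2 * y := fun y ↦ le_mul_of_one_le_left' (by norm_num)
        refine mul_le_mul_right ?_ _
        exact add_le_add (add_le_add (add_le_add (h2 _) (h2 _)) (h2 _)) (by gcongr)
    _ = K * 2 * (V * a + V * b + V * c + ENNReal.ofReal J) := by ring

/-- Unlike the equality `lintegral_tsum`, this needs no measurability. -/
lemma tsum_lintegral_le {α ι : Type*} [MeasurableSpace α] (μ : Measure α)
    (F : ι → α → ℝ≥0∞) : ∑' i, ∫⁻ a, F i a ∂μ ≤ ∫⁻ a, ∑' i, F i a ∂μ := by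
  classical
  have hfin : ∀ s : Finset ι, ∑ i ∈ s, ∫⁻ a, F i a ∂μ ≤ ∫⁻ a, ∑ i ∈ s, F i a ∂μ := by
    intro s
    induction s using Finset.induction_on with
    | empty => simp
    | insert i s hi ih =>
      simp only [Finset.sum_insert hi]
      exact (add_le_add_right ih _).trans (le_lintegral_add _ _)
  rw [ENNReal.tsum_eq_iSup_sum]
  exact iSup_le fun s ↦ (hfin s).trans (lintegral_mono fun a ↦ ENNReal.sum_le_tsum s)

/-- The a priori estimate of `Y_t` in `L¹_T(𝓑^{3/2,1/2})`. -/
theorem IsSolution.L1TNorm_anisoBesovNorm_le {φ : ℝ → ℝ} (hφ : IsDyadicProfile φ) {T : ℝ}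
    (hT : 0 < T) {f Y : ℝ → 𝓢'(Plane, Val)} {Yt : ℝ → PlaneL2} {Y₀ : 𝓢'(Plane, Val)}
    {Y₁ : PlaneL2} (h : IsSolution T f Y Yt Y₀ Y₁) :
    L1TNorm T (anisoBesovNorm φ (3 / 2) (1 / 2)) (fun t ↦ PlaneL2.toDist (Yt t)) ≤
      aprioriConst * (anisoBesovNorm φ (-1 / 2) (1 / 2) (PlaneL2.toDist Y₁) +
        anisoBesovNorm φ (-1 / 2) (1 / 2) (∂_{unitVec 0} Y₀) +
        anisoBesovNorm φ (-1 / 2) (1 / 2) (Δ Y₀) + L1TNorm T (anisoBesovNorm φ 0 0) f) := by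
  have hmeas : ∀ j k : ℤ, AEMeasurable (fun t ↦ (2 : ℝ≥0∞) ^ ((j : ℝ) * (3 / 2)) *
      (2 : ℝ≥0∞) ^ ((k : ℝ) * (1 / 2)) *
      distLpNorm 2 (isoBlock φ j (horBlock φ k (PlaneL2.toDist (Yt t)))))
      (volume.restrict (Icc 0 T)) := by
    intro j k
    simp only [distLpNorm_block_toDist hφ]
    refine AEMeasurable.const_mul ?_ _
    have hwc : ContinuousOn (fun t ↦ ‖blockL2 hφ j k (Yt t)‖ₑ) (Icc 0 T) :=
      continuous_enorm.comp_continuousOn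
        ((blockL2 hφ j k).continuous.comp_continuousOn h.contDiffOn.continuousOn)
    exact hwc.aemeasurable measurableSet_Icc
  have hLHS : L1TNorm T (anisoBesovNorm φ (3 / 2) (1 / 2)) (fun t ↦ PlaneL2.toDist (Yt t)) =
      ∑' (j : ℤ) (k : ℤ), ∫⁻ t in Icc 0 T, (2 : ℝ≥0∞) ^ ((j : ℝ) * (3 / 2)) *
        (2 : ℝ≥0∞) ^ ((k : ℝ) * (1 / 2)) *
        distLpNorm 2 (isoBlock φ j (horBlock φ k (PlaneL2.toDist (Yt t)))) := by
    unfold L1TNorm anisoBesovNorm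
    rw [lintegral_tsum fun j ↦ AEMeasurable.tsum fun k ↦ hmeas j k]
    exact tsum_congr fun j ↦ lintegral_tsum fun k ↦ hmeas j k
  have hf : ∑' (j : ℤ) (k : ℤ), ∫⁻ t in Icc 0 T, (2 : ℝ≥0∞) ^ ((j : ℝ) * 0) *
      (2 : ℝ≥0∞) ^ ((k : ℝ) * 0) * distLpNorm 2 (isoBlock φ j (horBlock φ k (f t))) ≤
      L1TNorm T (anisoBesovNorm φ 0 0) f :=
    (ENNReal.tsum_le_tsum fun j ↦ tsum_lintegral_le _ _).trans (tsum_lintegral_le _ _)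
  rw [hLHS]
  refine (ENNReal.tsum_le_tsum fun j ↦ ENNReal.tsum_le_tsum fun k ↦
    h.lintegral_block_le hφ j k hT).trans ?_
  simp only [ENNReal.tsum_mul_left, ENNReal.tsum_add]
  exact mul_le_mul_right (add_le_add le_rfl hf) _

/-! ### The gradient bound -/

lemma integral_fourierInv_smul_eq_of_integrable {ψ : Plane → ℂ} {h : Plane → Val}
    (hψ : Integrable ψ) (hh : Integrable h) : ∫ x, 𝓕⁻ ψ x • h x = ∫ x, ψ x • 𝓕⁻ h x := by
  have key := VectorFourier.integral_fourierIntegral_smul_eq_flip (L := -innerₗ Plane)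
    (μ := (volume : Measure Plane)) (ν := (volume : Measure Plane)) (f := ψ) (g := h)
    Real.continuous_fourierChar (by
      simp only [LinearMap.neg_apply, innerₗ_apply_apply]
      fun_prop) hψ hh
  simpa [VectorFourier.fourierIntegral, Real.fourierInv_eq, real_inner_comm] using key

/-- A distribution whose Fourier transform is an integrable function is a bounded function. -/
lemma distLpNorm_top_le_of_fourier {v : 𝓢'(Plane, Val)} {h : Plane → Val}
    (hh : AEStronglyMeasurable h volume) (hv : ∀ χ : 𝓢(Plane, ℂ), 𝓕 v χ = ∫ η, χ η • h η) :
    distLpNorm ∞ v ≤ ∫⁻ η, ‖h η‖ₑ := by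
  by_cases htop : ∫⁻ η, ‖h η‖ₑ = ⊤
  · rw [htop]
    exact le_top
  have hint : Integrable h := ⟨hh, lt_top_iff_ne_top.2 htop⟩
  have hcont : Continuous (𝓕⁻ h) := by
    rw [← Real.Lp.fourierTransformInv_toLp (memLp_one_iff_integrable.2 hint)]
    exact BoundedContinuousFunction.continuous _
  have hbound : ∀ x, ‖𝓕⁻ h x‖ₑ ≤ ∫⁻ η, ‖h η‖ₑ := fun x ↦ by
    rw [Real.fourierInv_eq]
    refine (enorm_integral_le_lintegral_enorm _).trans (lintegral_mono fun η ↦ ?_)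
    rw [Circle.smul_def, enorm_smul]
    rw [← ofReal_norm, Circle.norm_coe, ENNReal.ofReal_one, one_mul]
  have hmem : MemLp (𝓕⁻ h) ∞ (volume : Measure Plane) := by
    refine ⟨hcont.aestronglyMeasurable, ?_⟩
    rw [eLpNorm_exponent_top]
    exact (essSup_le_of_ae_le _ (.of_forall hbound)).trans_lt (lt_top_iff_ne_top.2 htop)
  have hrep : ((hmem.toLp _ : Lp Val ∞ (volume : Measure Plane)) : 𝓢'(Plane, Val)) = v := by
    ext ψ : 1
    have h1 : v ψ = 𝓕 v (𝓕⁻ ψ) := by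
      rw [TemperedDistribution.fourier_apply, FourierTransform.fourier_fourierInv_eq]
    rw [h1, hv, Lp.toTemperedDistribution_apply, SchwartzMap.fourierInv_coe,
      integral_fourierInv_smul_eq_of_integrable ψ.integrable hint]
    refine integral_congr_ae ?_
    filter_upwards [hmem.coeFn_toLp] with x hx
    rw [hx]
  refine (iInf_le_of_le (hmem.toLp _) (iInf_le_of_le hrep le_rfl)).trans ?_
  rw [Lp.enorm_toLp, eLpNorm_exponent_top]
  exact essSup_le_of_ae_le _ (.of_forall hbound)

/-- `‖∂ᵢu‖_{L^∞} ≤ ∫ |ξ| |û|`. -/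
lemma distLpNorm_top_lineDeriv_le (u : PlaneL2) (i : Fin 2) :
    distLpNorm ∞ (∂_{unitVec i} (PlaneL2.toDist u)) ≤
      ∫⁻ η : Plane, ‖2 * Real.pi * ‖η‖‖ₑ * ‖(𝓕 u : PlaneL2) η‖ₑ := by
  have hm : (fun η : Plane ↦ ((inner ℝ η (unitVec i) : ℝ) : ℂ)).HasTemperateGrowth := by fun_prop
  have hc : Continuous fun η : Plane ↦
      (2 * Real.pi * Complex.I : ℂ) * ((inner ℝ η (unitVec i) : ℝ) : ℂ) := by fun_prop
  refine (distLpNorm_top_le_of_fourier (h := fun η ↦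
    ((2 * Real.pi * Complex.I : ℂ) * ((inner ℝ η (unitVec i) : ℝ) : ℂ)) • (𝓕 u : PlaneL2) η)
    (hc.aestronglyMeasurable.smul (Lp.aestronglyMeasurable _)) fun χ ↦ ?_).trans ?_
  · rw [TemperedDistribution.fourier_lineDerivOp_eq, fourier_toDist, _root_.smul_apply,
      TemperedDistribution.smulLeftCLM_apply_apply, PlaneL2.toDist,
      Lp.toTemperedDistribution_apply, ← integral_smul]
    refine integral_congr_ae (.of_forall fun η ↦ ?_)
    simp only [SchwartzMap.smulLeftCLM_apply_apply hm, smul_smul, smul_eq_mul]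
    congr 1
    ring
  · refine lintegral_mono fun η ↦ ?_
    rw [enorm_smul]
    refine mul_le_mul_left ?_ _
    have h1 : ‖(2 * Real.pi * Complex.I : ℂ) * ((inner ℝ η (unitVec i) : ℝ) : ℂ)‖ ≤
        ‖2 * Real.pi * ‖η‖‖ := by
      have h2 : |inner ℝ η (unitVec i)| ≤ ‖η‖ := by
        refine (abs_real_inner_le_norm _ _).trans ?_
        simp [unitVec]
      simp only [norm_mul, Complex.norm_I, Complex.norm_real, Real.norm_eq_abs, abs_norm, mul_one]
      simp only [Complex.norm_ofNat, Nat.abs_ofNat]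
      gcongr
    exact enorm_le_iff_norm_le.2 h1

lemma IsDyadicProfile.one_le_tsum {φ : ℝ → ℝ} (hφ : IsDyadicProfile φ) {τ : ℝ} (hτ : 0 < τ) :
    1 ≤ ∑' j : ℤ, ‖φ ((2 : ℝ) ^ (-j) * τ)‖ₑ := by
  have h := enorm_tsum_le_tsum_enorm (f := fun j : ℤ ↦ φ ((2 : ℝ) ^ (-j) * τ))
  rw [(hφ.hasSum_one τ hτ).tsum_eq] at h
  simpa using h

lemma ae_coord_ne_zero : ∀ᵐ η : Plane, η 0 ≠ 0 := by
  have h : (volume : Measure Plane) (LinearMap.ker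
      (EuclideanSpace.proj (0 : Fin 2) : Plane →L[ℝ] ℝ).toLinearMap : Submodule ℝ Plane) = 0 := by
    refine Measure.addHaar_submodule _ _ fun htop ↦ ?_
    have : (unitVec 0) ∈ LinearMap.ker
        (EuclideanSpace.proj (0 : Fin 2) : Plane →L[ℝ] ℝ).toLinearMap := by
      rw [htop]
      exact Submodule.mem_top
    simp [unitVec] at this
  refine measure_mono_null (fun η hη ↦ ?_) h
  simpa using hη

/-- The blocks cover almost every frequency. -/
lemma IsDyadicProfile.ae_one_le_tsum_blockSymbol {φ : ℝ → ℝ} (hφ : IsDyadicProfile φ) :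
    ∀ᵐ η : Plane, 1 ≤ ∑' (j : ℤ) (k : ℤ), ‖blockSymbol φ j k η‖ₑ := by
  filter_upwards [ae_coord_ne_zero] with η hη
  have h0 : η ≠ 0 := fun h ↦ hη (by rw [h]; rfl)
  have e : ∀ j k : ℤ, ‖blockSymbol φ j k η‖ₑ =
      ‖φ ((2 : ℝ) ^ (-j) * (2 * Real.pi * ‖η‖))‖ₑ *
        ‖φ ((2 : ℝ) ^ (-k) * (2 * Real.pi * |η 0|))‖ₑ := fun j k ↦ by
    rw [blockSymbol, enorm_mul, mul_comm]
    congr 1 <;> simp [isoSymbol, horSymbol, enorm_eq_nnnorm]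
  simp only [e, ENNReal.tsum_mul_left, ENNReal.tsum_mul_right]
  exact one_le_mul (hφ.one_le_tsum (by positivity)) (hφ.one_le_tsum (by positivity))

lemma volume_blockRegion_le (j k : ℤ) :
    (volume : Measure Plane) (blockRegion j k) ≤ 4 * 2 ^ ((j : ℝ) + k) := by
  have hsub : blockRegion j k ⊆ (WithLp.ofLp : Plane → Fin 2 → ℝ) ⁻¹'
      Icc ![-(2 : ℝ) ^ k, -(2 : ℝ) ^ j] ![(2 : ℝ) ^ k, (2 : ℝ) ^ j] := by
    intro η hη
    have hpi := Real.pi_gt_three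
    have h1 : |η 1| ≤ ‖η‖ := by simpa using PiLp.norm_apply_le η 1
    have h2j : (0 : ℝ) < 2 ^ j := by positivity
    have h2k : (0 : ℝ) < 2 ^ k := by positivity
    have h3 : |η 0| ≤ 2 ^ k := by nlinarith [hη.2.2, abs_nonneg (η 0)]
    have h4 : |η 1| ≤ 2 ^ j := by nlinarith [hη.1.2, norm_nonneg η]
    refine ⟨fun i ↦ ?_, fun i ↦ ?_⟩ <;> fin_cases i
    · exact (abs_le.1 h3).1
    · exact (abs_le.1 h4).1
    · exact (abs_le.1 h3).2
    · exact (abs_le.1 h4).2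
  refine (measure_mono hsub).trans ?_
  rw [(PiLp.volume_preserving_ofLp (Fin 2)).measure_preimage measurableSet_Icc.nullMeasurableSet,
    Real.volume_Icc_pi, Fin.prod_univ_two]
  simp only [Matrix.cons_val_zero, Matrix.cons_val_one, sub_neg_eq_add, ← two_mul]
  have e : ∀ l : ℤ, ENNReal.ofReal (2 * (2 : ℝ) ^ l) = 2 * 2 ^ (l : ℝ) := fun l ↦ by
    rw [ENNReal.ofReal_mul (by norm_num), ← Real.rpow_intCast,
      ← ENNReal.ofReal_rpow_of_pos (by norm_num), ENNReal.ofReal_ofNat]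
  rw [e, e, ← two_rpow_mul_two_rpow]
  apply le_of_eq
  ring

lemma blockL2_ae_eq {φ : ℝ → ℝ} (hφ : IsDyadicProfile φ) (j k : ℤ) (u : PlaneL2) :
    blockL2 hφ j k u =ᵐ[volume] fun η ↦ blockSymbol φ j k η • (𝓕 u : PlaneL2) η :=
  coeFn_mulL2 (hφ.memLp_blockSymbol j k) (𝓕 u)

/-- The Bernstein inequality for one block: Cauchy-Schwarz on a region of area `≲ 2^{j+k}`. -/
lemma lintegral_blockL2_le {φ : ℝ → ℝ} (hφ : IsDyadicProfile φ) (j k : ℤ) (u : PlaneL2) :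
    ∫⁻ η : Plane, ‖2 * Real.pi * ‖η‖‖ₑ * ‖blockL2 hφ j k u η‖ₑ ≤
      6 * ((2 : ℝ≥0∞) ^ ((j : ℝ) * (3 / 2)) * (2 : ℝ≥0∞) ^ ((k : ℝ) * (1 / 2)) *
        ‖blockL2 hφ j k u‖ₑ) := by
  set w := blockL2 hφ j k u with hw
  set B := blockRegion j k with hB
  have hBm : MeasurableSet B := (isClosed_blockRegion j k).measurableSet
  have h1 : ∫⁻ η : Plane, ‖2 * Real.pi * ‖η‖‖ₑ * ‖w η‖ₑ ≤
      ∫⁻ η in B, ENNReal.ofReal (8 / 3 * (2 : ℝ) ^ j) * ‖w η‖ₑ := by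
    rw [← lintegral_indicator hBm]
    refine lintegral_mono_ae ?_
    filter_upwards [blockL2_ae_eq hφ j k u] with η hη
    by_cases hηB : η ∈ B
    · rw [indicator_of_mem hηB]
      refine mul_le_mul_left ?_ _
      rw [← ofReal_norm, Real.norm_eq_abs, abs_of_nonneg (by positivity)]
      exact ENNReal.ofReal_le_ofReal hηB.1.2
    · rw [hw, hη, hφ.blockSymbol_eq_zero hηB]
      simp
  have h2 : ∫⁻ η in B, ‖w η‖ₑ ≤ ‖w‖ₑ * (2 * 2 ^ (((j : ℝ) + k) * (1 / 2))) := by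
    have h3 := eLpNorm_le_eLpNorm_mul_rpow_measure_univ (p := 1) (q := 2) (by norm_num)
      (Lp.aestronglyMeasurable w).restrict (μ := volume.restrict B)
    rw [eLpNorm_one_eq_lintegral_enorm, Measure.restrict_apply_univ] at h3
    refine h3.trans (mul_le_mul' ?_ ?_)
    · rw [Lp.enorm_def]
      exact eLpNorm_mono_measure _ Measure.restrict_le_self
    · have e : (1 / (1 : ℝ≥0∞).toReal - 1 / (2 : ℝ≥0∞).toReal) = 1 / 2 := by norm_num
      rw [e]
      refine (ENNReal.rpow_le_rpow (volume_blockRegion_le j k) (by norm_num)).trans ?_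
      rw [ENNReal.mul_rpow_of_nonneg _ _ (by norm_num), ← ENNReal.rpow_mul]
      refine mul_le_mul_left ?_ _
      have e4 : (4 : ℝ≥0∞) = 2 ^ (2 : ℝ) := by norm_num
      rw [e4, ← ENNReal.rpow_mul]
      norm_num
  have h83 : ENNReal.ofReal (8 / 3 * (2 : ℝ) ^ j) ≤ 3 * 2 ^ (j : ℝ) := by
    rw [ENNReal.ofReal_mul (by norm_num), ← Real.rpow_intCast,
      ← ENNReal.ofReal_rpow_of_pos (by norm_num), ENNReal.ofReal_ofNat]
    refine mul_le_mul_left ?_ _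
    rw [ENNReal.ofReal_le_iff_le_toReal (by norm_num)]
    norm_num
  calc _ ≤ ENNReal.ofReal (8 / 3 * (2 : ℝ) ^ j) * ∫⁻ η in B, ‖w η‖ₑ := by
        rw [← lintegral_const_mul' _ _ ENNReal.ofReal_ne_top]
        exact h1
    _ ≤ 3 * 2 ^ (j : ℝ) * (‖w‖ₑ * (2 * 2 ^ (((j : ℝ) + k) * (1 / 2)))) := mul_le_mul' h83 h2
    _ = 6 * ((2 ^ (j : ℝ) * 2 ^ (((j : ℝ) + k) * (1 / 2))) * ‖w‖ₑ) := by ring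
    _ = _ := by
        rw [two_rpow_mul_two_rpow, two_rpow_mul_two_rpow]
        congr 3
        ring

/-- The embedding of `𝓑^{3/2,1/2}` into functions with bounded gradient, for `L²` functions.  It
holds for each time separately, so the integrated bound follows by monotonicity. -/
theorem gradSupNorm_toDist_le {φ : ℝ → ℝ} (hφ : IsDyadicProfile φ) (u : PlaneL2) :
    gradSupNorm (PlaneL2.toDist u) ≤
      12 * anisoBesovNorm φ (3 / 2) (1 / 2) (PlaneL2.toDist u) := by
  have key : ∫⁻ η : Plane, ‖2 * Real.pi * ‖η‖‖ₑ * ‖(𝓕 u : PlaneL2) η‖ₑ ≤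
      6 * anisoBesovNorm φ (3 / 2) (1 / 2) (PlaneL2.toDist u) := by
    have hmeas : ∀ j k : ℤ, AEMeasurable
        (fun η : Plane ↦ ‖2 * Real.pi * ‖η‖‖ₑ * ‖blockL2 hφ j k u η‖ₑ) := fun j k ↦
      (by fun_prop : Continuous fun η : Plane ↦ 2 * Real.pi * ‖η‖).enorm.aemeasurable.mul
        (Lp.aestronglyMeasurable _).enorm
    have hae : ∀ᵐ η : Plane, ∀ j k : ℤ,
        blockL2 hφ j k u η = blockSymbol φ j k η • (𝓕 u : PlaneL2) η :=
      ae_all_iff.2 fun j ↦ ae_all_iff.2 fun k ↦ blockL2_ae_eq hφ j k u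
    calc ∫⁻ η : Plane, ‖2 * Real.pi * ‖η‖‖ₑ * ‖(𝓕 u : PlaneL2) η‖ₑ
        ≤ ∫⁻ η : Plane, ∑' (j : ℤ) (k : ℤ), ‖2 * Real.pi * ‖η‖‖ₑ * ‖blockL2 hφ j k u η‖ₑ := by
          refine lintegral_mono_ae ?_
          filter_upwards [hae, hφ.ae_one_le_tsum_blockSymbol] with η h1 h2
          simp only [h1, enorm_smul, ENNReal.tsum_mul_left, ENNReal.tsum_mul_right]
          exact mul_le_mul_right (le_mul_of_one_le_left' h2) _
      _ = ∑' (j : ℤ) (k : ℤ), ∫⁻ η : Plane, ‖2 * Real.pi * ‖η‖‖ₑ * ‖blockL2 hφ j k u η‖ₑ := by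
          rw [lintegral_tsum fun j ↦ AEMeasurable.tsum fun k ↦ hmeas j k]
          exact tsum_congr fun j ↦ lintegral_tsum fun k ↦ hmeas j k
      _ ≤ ∑' (j : ℤ) (k : ℤ), 6 * ((2 : ℝ≥0∞) ^ ((j : ℝ) * (3 / 2)) *
            (2 : ℝ≥0∞) ^ ((k : ℝ) * (1 / 2)) * ‖blockL2 hφ j k u‖ₑ) :=
          ENNReal.tsum_le_tsum fun j ↦ ENNReal.tsum_le_tsum fun k ↦ lintegral_blockL2_le hφ j k u
      _ = _ := by
          simp only [ENNReal.tsum_mul_left, anisoBesovNorm, distLpNorm_block_toDist hφ]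
  calc gradSupNorm (PlaneL2.toDist u)
      ≤ ∑ _i : Fin 2, 6 * anisoBesovNorm φ (3 / 2) (1 / 2) (PlaneL2.toDist u) :=
        Finset.sum_le_sum fun i _ ↦ (distLpNorm_top_lineDeriv_le u i).trans key
    _ = _ := by
        rw [Fin.sum_univ_two]
        ring

end

theorem mainTheorem4 (φ : ℝ → ℝ) (hφ : IsDyadicProfile φ) :
    ∃ C : ℝ≥0, ∀ (T : ℝ) (_ : 0 < T) (f Y : ℝ → 𝓢'(Plane, Val)) (Yt : ℝ → PlaneL2)
      (Y₀ : 𝓢'(Plane, Val)) (Y₁ : PlaneL2), IsSolution T f Y Yt Y₀ Y₁ →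
      L1TNorm T gradSupNorm (fun t ↦ PlaneL2.toDist (Yt t)) ≤
        C * L1TNorm T (anisoBesovNorm φ (3 / 2) (1 / 2)) (fun t ↦ PlaneL2.toDist (Yt t)) ∧
      L1TNorm T (anisoBesovNorm φ (3 / 2) (1 / 2)) (fun t ↦ PlaneL2.toDist (Yt t)) ≤
        C * (anisoBesovNorm φ (-1 / 2) (1 / 2) (PlaneL2.toDist Y₁) +
          anisoBesovNorm φ (-1 / 2) (1 / 2) (∂_{unitVec 0} Y₀) +
          anisoBesovNorm φ (-1 / 2) (1 / 2) (Δ Y₀) +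
          L1TNorm T (anisoBesovNorm φ 0 0) f) := by
  refine ⟨max 12 aprioriConst, fun T hT f Y Yt Y₀ Y₁ h ↦ ⟨?_, ?_⟩⟩
  · have h12 : (12 : ℝ≥0∞) ≤ (max 12 aprioriConst : ℝ≥0) := by
      exact_mod_cast le_max_left 12 aprioriConst
    unfold L1TNorm
    rw [← lintegral_const_mul' _ _ ENNReal.coe_ne_top]
    exact lintegral_mono fun t ↦ (gradSupNorm_toDist_le hφ (Yt t)).trans (mul_le_mul_left h12 _)
  · refine (h.L1TNorm_anisoBesovNorm_le hφ hT).trans (mul_le_mul_left ?_ _)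
    exact_mod_cast le_max_right 12 aprioriConst
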